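/- Let $\Phi_W=\{x_i\}$ (Wi-Fi access points, APs) and $\Phi_L=\{y_k\}$ (LTE eNBs) be independent homogeneous Poisson point processes in $\mathbb{R}^2$ with intensities $\lambda_W>0$ and $\lambda_L\ge 0$. Let $P_W,P_L>0$ be the transmit powers of APs and eNBs, $\Gamma_{cs},\Gamma_{ed}>0$ the carrier sensing and energy detection thresholds, and let the path loss be $l(d)=(4\pi/\lambda_c)^2 d^{\alpha}$ with wavelength $\lambda_c>0$ and exponent $\alpha>0$. Each AP $x_i$ has a back-off timer $t_i^W$ uniform on $[0,1]$; the fading variables $G^W_{ji}$ (from AP $x_j$ to AP $x_i$) and $G^{LW}_{ki}$ (from eNB $y_k$ to AP $x_i$) are exponential with parameter $\mu>0$; all timers and fading variables are mutually independent and independent of $(\Phi_W,\Phi_L)$. When LTE transmits continuously, the medium access indicator of AP $x_i$ is $$e_i^W=\prod_{y_k\in\Phi_L}\mathbf 1_{\{G^{LW}_{ki}/l(\|y_k-x_i\|)\le \Gamma_{ed}/P_L\}}\prod_{x_j\in\Phi_W\setminus\{x_i\}}\Bigl(\mathbf 1_{\{t_j^W\ge t_i^W\}}+\mathbf 1_{\{t_j^W<t_i^W\}}\mathbf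 1_{\{G^W_{ji}/l(\|x_j-x_i\|)\le \Gamma_{cs}/P_W\}}\Bigr).$$ Almost surely there is a unique AP $x_0$ closest to the origin (the tagged AP); its distance $\|x_0\|$ has density $f_W(r)=2\pi\lambda_W r\,e^{-\lambda_W\pi r^2}$ on $(0,\infty)$, and the medium access probability of the tagged AP, $\mathbb{P}(e_0^W=1)$, is given by the convergent integral $$\mathbb{P}(e_0^W=1)=\int_0^\infty \frac{1-e^{-N_2^W(r_0)}}{N_2^W(r_0)}\,e^{-N^L}f_W(r_0)\,dr_0,$$ where, with $B(0,r)$ the closed disc of radius $r$ about the origin, $$N_2^W(r)=\lambda_W\int_{\mathbb{R}^2\setminus B(0,r)}\exp\Bigl(-\mu\frac{\Gamma_{cs}}{P_W}\,l(\|x-(r,0)\|)\Bigr)dx,\qquad N^L=\lambda_L\int_{\mathbb{R}^2}\exp\Bigl(-\mu\frac{\Gamma_{ed}}{P_L}\,l(\|x\|)\Bigr)dx.$$ -/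

import Mathlib

open MeasureTheory ProbabilityTheory

noncomputable section

namespace WiFiLTE

/-- The Euclidean plane. -/
abbrev Plane : Type := EuclideanSpace ℝ (Fin 2)

/-- The number of indices `i` with `ξ i ω ∈ A`, that is, the number of points (counted with
multiplicity) of the point process `{ξ i}` in the set `A`. -/
def count {Ω ι : Type*} (ξ : ι → Ω → Plane) (A : Set Plane) (ω : Ω) : ℕ∞ :=
  {i | ξ i ω ∈ A}.encard

/-- The random points `ξ i` form a homogeneous Poisson point process of intensity `lam`
in the plane: the number of points in a set of finite area is Poisson distributed with mean
`lam` times the area, and the numbers of points in disjoint sets are independent. -/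
structure IsPoissonProcess {Ω ι : Type*} [MeasurableSpace Ω] (P : Measure Ω)
    (lam : ℝ) (ξ : ι → Ω → Plane) : Prop where
  measurable : ∀ i, Measurable (ξ i)
  law : ∀ A : Set Plane, MeasurableSet A → volume A ≠ ⊤ →
    HasLaw (count ξ A)
      ((poissonMeasure (lam * volume.real A).toNNReal).map (Nat.cast : ℕ → ℕ∞)) P
  indep : ∀ (n : ℕ) (A : Fin n → Set Plane), (∀ k, MeasurableSet (A k)) →
    (∀ k, volume (A k) ≠ ⊤) → Pairwise (fun k l => Disjoint (A k) (A l)) →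
    iIndepFun (fun k => count ξ (A k)) P

/-- System parameters. The eNB intensity may vanish (no LTE network). -/
structure Params where
  /-- intensity of the Wi-Fi access points -/
  lamW : ℝ
  /-- intensity of the LTE eNBs -/
  lamL : ℝ
  /-- transmit power of an AP -/
  PW : ℝ
  /-- transmit power of an eNB -/
  PL : ℝ
  /-- carrier sensing threshold -/
  Γcs : ℝ
  /-- energy detection threshold -/
  Γed : ℝ
  /-- parameter of the exponential fading variables -/
  μ : ℝ
  /-- path loss exponent -/
  α : ℝ
  /-- carrier wavelength -/
  wavelength : ℝ
  lamW_pos : 0 < lamW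
  lamL_nonneg : 0 ≤ lamL
  PW_pos : 0 < PW
  PL_pos : 0 < PL
  Γcs_pos : 0 < Γcs
  Γed_pos : 0 < Γed
  μ_pos : 0 < μ
  α_pos : 0 < α
  wavelength_pos : 0 < wavelength

namespace Params

variable (p : Params)

/-- Path loss in linear scale; in decibels this is
`20 log₁₀ (4π / wavelength) + 10 α log₁₀ d`. -/
def pathLoss (d : ℝ) : ℝ := (4 * Real.pi / p.wavelength) ^ 2 * d ^ p.α

/-- `N^W_0(y, r, Γ)`: mean number of APs outside the closed ball of radius `r` about the origin
whose power received at `y` exceeds `Γ`. -/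
def NW0 (y : Plane) (r Γ : ℝ) : ℝ :=
  p.lamW * ∫ x in (Metric.closedBall (0 : Plane) r)ᶜ,
    Real.exp (-p.μ * (Γ / p.PW) * p.pathLoss ‖x - y‖)

/-- `N^L_0(y, r, Γ)`: the same for the eNBs. -/
def NL0 (y : Plane) (r Γ : ℝ) : ℝ :=
  p.lamL * ∫ x in (Metric.closedBall (0 : Plane) r)ᶜ,
    Real.exp (-p.μ * (Γ / p.PL) * p.pathLoss ‖x - y‖)

/-- `N^W_2(r) = N^W_0((r, 0), r, Γ_cs)`. -/
def NW2 (r : ℝ) : ℝ := p.NW0 !₂[r, 0] r p.Γcs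

/-- `N^L = N^L_0(o, 0, Γ_ed)`. -/
def NL : ℝ := p.NL0 0 0 p.Γed

/-- `f_W`, the density of the distance from the origin to the nearest AP. -/
def fW (r : ℝ) : ℝ := p.lamW * (2 * Real.pi * r) * Real.exp (-p.lamW * Real.pi * r ^ 2)

end Params

/-- The backoff timers and all the fading variables, as one family. -/
def marks {Ω κ : Type*} (t : ℕ → Ω → ℝ) (GW : ℕ → ℕ → Ω → ℝ) (GLW : κ → ℕ → Ω → ℝ) :
    (ℕ ⊕ (ℕ × ℕ) ⊕ (κ × ℕ)) → Ω → ℝ :=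
  Sum.elim t (Sum.elim (fun q => GW q.1 q.2) (fun q => GLW q.1 q.2))

/-- The network model.
* `x i` are the locations of the APs and `y k` those of the eNBs. These are independent
  homogeneous Poisson point processes. The eNBs are indexed by a countable type, so that it
  can be empty when `lamL = 0`.
* `t i` is the backoff timer of the `i`-th AP, uniform on `[0,1]`.
* `GW j i` is the fading of the channel from the `j`-th AP to the `i`-th AP, and `GLW k i` that
  of the channel from the `k`-th eNB to the `i`-th AP; all are exponential with parameter `μ`.
* Timers and fading variables are mutually independent, and independent of the locations. -/
structure IsNetwork {Ω κ : Type*} [MeasurableSpace Ω] (P : Measure Ω) (p : Params)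
    (x : ℕ → Ω → Plane) (y : κ → Ω → Plane) (t : ℕ → Ω → ℝ)
    (GW : ℕ → ℕ → Ω → ℝ) (GLW : κ → ℕ → Ω → ℝ) : Prop where
  poissonW : IsPoissonProcess P p.lamW x
  poissonL : IsPoissonProcess P p.lamL y
  measurable_marks : ∀ m, Measurable (marks t GW GLW m)
  law_t : ∀ i, HasLaw (t i) (volume.restrict (Set.Icc (0 : ℝ) 1)) P
  law_GW : ∀ j i, HasLaw (GW j i) (expMeasure p.μ) P
  law_GLW : ∀ k i, HasLaw (GLW k i) (expMeasure p.μ) P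
  indep_marks : iIndepFun (marks t GW GLW) P
  indep_locations : IndepFun (fun ω i => x i ω) (fun ω k => y k ω) P
  indep_locations_marks : IndepFun (fun ω => ((fun i => x i ω), (fun k => y k ω)))
    (fun ω m => marks t GW GLW m ω) P

open Classical in
/-- Medium access indicator `e_i^W` of the `i`-th AP under continuous LTE transmission. It is the
product of the 0-1 factors: it equals `1` iff no eNB is received above `Γ_ed` and no other AP with
a smaller timer is received above `Γ_cs`. -/
def accessIndicator {Ω κ : Type*} (p : Params) (x : ℕ → Ω → Plane) (y : κ → Ω → Plane)
    (t : ℕ → Ω → ℝ) (GW : ℕ → ℕ → Ω → ℝ) (GLW : κ → ℕ → Ω → ℝ) (i : ℕ) (ω : Ω) : ℝ :=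
  if (∀ k, GLW k i ω / p.pathLoss ‖y k ω - x i ω‖ ≤ p.Γed / p.PL) ∧
      (∀ j, j ≠ i → t j ω < t i ω →
        GW j i ω / p.pathLoss ‖x j ω - x i ω‖ ≤ p.Γcs / p.PW)
  then 1 else 0

/-- Index of the tagged AP: the AP closest to the typical station, which is at the origin. (It is
the least such index; the value is junk on the null event that there is no closest AP.) -/
def tagged {Ω : Type*} (x : ℕ → Ω → Plane) (ω : Ω) : ℕ :=
  sInf {i | ∀ j, ‖x i ω‖ ≤ ‖x j ω‖}

end WiFiLTE

end

noncomputable section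

namespace WiFiLTE

open scoped ENNReal
open Filter Topology

/-! Fix all locations and the timer `s` of the `i`-th AP. By independence of the marks, the
probability that this AP is strictly nearest to the origin and gets access is a product: one factor
per eNB, and one factor `1_{‖x_i‖ < ‖x_j‖} (1 - s h(x_j - x_i))` per other AP, where `h` is the
exponential tail `detect`. The nearest-point constraint thus becomes part of the pair kernel
`farther (p.quiet s)`, and no conditioning on the tagged AP is needed.

Averaging over the eNBs turns their product into `exp (-N^L)` whatever `x_i` is, by translation
invariance. Summing over `i`, the AP part is evaluated by the multiplicative Campbell–Mecke formula
`E ∑_i g(x_i) ∏_{j ≠ i} u(x_i, x_j) = λ ∫ g(z) exp (-λ ∫ (1 - u(z, w)) dw) dz`. For the kernel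
above, `λ ∫ (1 - u(z, w)) dw = λ π ‖z‖² + s N_2^W(‖z‖)`: the disc must be empty, and the points
outside it are thinned. In polar coordinates `λ exp (-λ π ‖z‖²) dz` is `f_W(r) dr`, and integrating
over `s` in `[0, 1]` gives `(1 - exp (-N)) / N`. At `s = 0` the same formula yields the law of the
nearest distance, and since `f_W` has mass one, almost sure existence of a unique nearest AP.

The Campbell–Mecke formula is derived from the laws and independence of counts alone. For kernels
constant on the cells of a finite partition it is a computation with Poisson variables
(`lintegral_pairSum_simple`). Approximation of the kernel and growing windows give the general case
(`lintegral_pairSum_window`, `lintegral_pairSum_farther`). The probability generating functional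
(`lintegral_infProd`), used for the eNBs, follows the same route. The pieces meet in `measure_event`
and `measure_access`. -/

/-! ### Infinite products of factors at most one -/

/-- The infimum of the finite subproducts; for factors in `[0, 1]` this is the infinite product. -/
def infProd {ι : Type*} (f : ι → ℝ≥0∞) : ℝ≥0∞ := ⨅ S : Finset ι, ∏ j ∈ S, f j

section InfProd

variable {ι : Type*} {f : ι → ℝ≥0∞}

lemma infProd_le_one : infProd f ≤ 1 := (iInf_le _ ∅).trans (by simp)

lemma infProd_mono {g : ι → ℝ≥0∞} (h : ∀ j, f j ≤ g j) : infProd f ≤ infProd g :=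
  iInf_mono fun _ => Finset.prod_le_prod' fun j _ => h j

lemma prod_anti (hf : ∀ j, f j ≤ 1) : Antitone fun S : Finset ι => ∏ j ∈ S, f j :=
  fun _ _ h => Finset.prod_le_prod_of_subset_of_le_one' h fun j _ _ => hf j

lemma infProd_eq_prod (hf : ∀ j, f j ≤ 1) {J : Finset ι} (hJ : ∀ j, j ∉ J → f j = 1) :
    infProd f = ∏ j ∈ J, f j := by
  classical
  refine le_antisymm (iInf_le _ J) (le_iInf fun S => ?_)
  calc ∏ j ∈ J, f j = ∏ j ∈ J ∪ S, f j :=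
        Finset.prod_subset Finset.subset_union_left fun j _ hj => hJ j hj
    _ ≤ ∏ j ∈ S, f j := prod_anti hf Finset.subset_union_right

/-- A finite subproduct has finitely many factors, and all of them have reached their limits at a
common index. This is what lets windows grow to the whole plane. -/
lemma infProd_eq_iInf {F : ℕ → ι → ℝ≥0∞} (hF : ∀ j, Antitone fun n => F n j)
    (hle : ∀ n j, f j ≤ F n j) (hev : ∀ j, ∃ n, F n j = f j) :
    infProd f = ⨅ n, infProd (F n) := by
  refine le_antisymm (le_iInf fun n => infProd_mono (hle n)) (le_iInf fun S => ?_)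
  choose N hN using hev
  refine (iInf_le _ (S.sup N)).trans ((iInf_le _ S).trans (Finset.prod_le_prod' fun j hj => ?_))
  exact (hF j (Finset.le_sup hj)).trans (hN j).le

lemma infProd_sum_elim {κ : Type*} {g : κ → ℝ≥0∞} :
    infProd (Sum.elim f g) = infProd f * infProd g := by
  classical
  have key : ∀ (S : Finset ι) (T : Finset κ), ∏ j ∈ S.disjSum T, Sum.elim f g j =
      (∏ j ∈ S, f j) * ∏ j ∈ T, g j := fun S T => by
    rw [Finset.prod_disjSum]; simp
  refine le_antisymm ?_ (le_iInf fun U => ?_)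
  -- The empty subproducts equal `1`, which excludes the indeterminate form `0 * ⊤`.
  · refine ENNReal.le_iInf_mul_iInf ⟨∅, by simp⟩ ⟨∅, by simp⟩ fun S T => ?_
    rw [← key]
    exact iInf_le _ _
  · rw [← Finset.toLeft_disjSum_toRight (u := U), key]
    exact mul_le_mul' (iInf_le _ _) (iInf_le _ _)

lemma measurable_infProd {α : Type*} [MeasurableSpace α] [Countable ι] {F : ι → α → ℝ≥0∞}
    (hF : ∀ j, Measurable (F j)) : Measurable fun a => infProd fun j => F j a :=
  Measurable.iInf fun S => Finset.measurable_prod S fun j _ => hF j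

end InfProd

/-! ### Counts of a Poisson process -/

section Poisson

variable {Ω ι : Type*} [MeasurableSpace Ω] {P : Measure Ω} {lam : ℝ} {ξ : ι → Ω → Plane}

lemma IsPoissonProcess.lintegral_count (h : IsPoissonProcess P lam ξ) (hlam : 0 ≤ lam)
    {A : Set Plane} (hA : MeasurableSet A) (hA' : volume A ≠ ⊤) (F : ℕ∞ → ℝ≥0∞) :
    ∫⁻ ω, F (count ξ A ω) ∂P = ∑' n : ℕ, ENNReal.ofReal
      (Real.exp (-(lam * volume.real A)) * (lam * volume.real A) ^ n / n.factorial) * F n := by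
  have hm : 0 ≤ lam * volume.real A := by positivity
  rw [(h.law A hA hA').lintegral_comp (f := F) Measurable.of_discrete.aemeasurable,
    lintegral_map Measurable.of_discrete Measurable.of_discrete, poissonMeasure,
    lintegral_sum_measure]
  simp [lintegral_smul_measure, Real.coe_toNNReal _ hm]

lemma IsPoissonProcess.ae_finite (h : IsPoissonProcess P lam ξ)
    {A : Set Plane} (hA : MeasurableSet A) (hA' : volume A ≠ ⊤) :
    ∀ᵐ ω ∂P, {i | ξ i ω ∈ A}.Finite := by
  have := ((h.law A hA hA').ae_iff (p := fun n => n ≠ ⊤) Measurable.of_discrete).2 (by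
    rw [ae_map_iff Measurable.of_discrete.aemeasurable (by measurability)]
    exact ae_of_all _ fun n => by simp)
  filter_upwards [this] with ω hω
  exact Set.encard_ne_top_iff.1 hω

lemma IsPoissonProcess.lintegral_pow_count (h : IsPoissonProcess P lam ξ) (hlam : 0 ≤ lam)
    {A : Set Plane} (hA : MeasurableSet A) (hA' : volume A ≠ ⊤) {a : ℝ} (ha : 0 ≤ a) :
    ∫⁻ ω, ENNReal.ofReal a ^ (count ξ A ω).toNat ∂P =
      ENNReal.ofReal (Real.exp (-(lam * volume.real A * (1 - a)))) := by
  rw [h.lintegral_count hlam hA hA' (fun n => ENNReal.ofReal a ^ n.toNat)]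
  have hm : 0 ≤ lam * volume.real A := by positivity
  generalize lam * volume.real A = m at hm
  have hs : HasSum (fun n : ℕ => Real.exp (-m) * ((m * a) ^ n / n.factorial))
      (Real.exp (-m) * Real.exp (m * a)) := by
    have := NormedSpace.expSeries_div_hasSum_exp (m * a)
    rw [← Real.exp_eq_exp_ℝ] at this
    exact this.mul_left _
  rw [show -(m * (1 - a)) = -m + m * a by ring, Real.exp_add, ← hs.tsum_eq,
    ENNReal.ofReal_tsum_of_nonneg (fun n => by positivity) hs.summable]
  refine tsum_congr fun n => ?_
  rw [ENat.toNat_natCast, ← ENNReal.ofReal_pow ha, ← ENNReal.ofReal_mul (by positivity), mul_pow]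
  congr 1; ring

/-- Derivative in `a` of the generating function `exp (-m (1 - a))`. The factor `m` is the source of
the intensity measure in the Campbell–Mecke formula; `a = 1` gives the mean count. -/
lemma IsPoissonProcess.lintegral_count_mul_pow (h : IsPoissonProcess P lam ξ) (hlam : 0 ≤ lam)
    {A : Set Plane} (hA : MeasurableSet A) (hA' : volume A ≠ ⊤) {a : ℝ} (ha : 0 ≤ a) :
    ∫⁻ ω, (count ξ A ω).toNat * ENNReal.ofReal a ^ ((count ξ A ω).toNat - 1) ∂P =
      ENNReal.ofReal (lam * volume.real A * Real.exp (-(lam * volume.real A * (1 - a)))) := by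
  rw [h.lintegral_count hlam hA hA' (fun n => n.toNat * ENNReal.ofReal a ^ (n.toNat - 1))]
  have hm : 0 ≤ lam * volume.real A := by positivity
  generalize lam * volume.real A = m at hm
  have hs : HasSum (fun n : ℕ => m * (Real.exp (-m) * ((m * a) ^ n / n.factorial)))
      (m * (Real.exp (-m) * Real.exp (m * a))) := by
    have := NormedSpace.expSeries_div_hasSum_exp (m * a)
    rw [← Real.exp_eq_exp_ℝ] at this
    exact (this.mul_left _).mul_left _
  rw [show -(m * (1 - a)) = -m + m * a by ring, Real.exp_add, ← hs.tsum_eq,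
    ENNReal.ofReal_tsum_of_nonneg (fun n => by positivity) hs.summable]
  -- The term `n = 0` vanishes through its factor `n`, so the truncated exponent `0 - 1` is
  -- harmless.
  refine (tsum_eq_zero_add' ENNReal.summable).trans ?_
  simp only [ENat.toNat_natCast, ENat.toNat_zero, Nat.cast_zero, zero_mul, mul_zero, zero_add]
  refine tsum_congr fun n => ?_
  rw [← ENNReal.ofReal_pow ha, ← ENNReal.ofReal_natCast, ← ENNReal.ofReal_mul (by positivity),
    ← ENNReal.ofReal_mul (by positivity), mul_pow, Nat.factorial_succ]
  congr 1
  have : ((n + 1 : ℕ) : ℝ) ≠ 0 := by positivity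
  push_cast at this ⊢
  field_simp
  ring

lemma IsPoissonProcess.lintegral_prod_count [IsProbabilityMeasure P]
    (h : IsPoissonProcess P lam ξ) {β : Type*} (s : Finset β) (C : β → Set Plane)
    (hC : ∀ c, MeasurableSet (C c)) (hC' : ∀ c, volume (C c) ≠ ⊤)
    (hd : Pairwise fun c d => Disjoint (C c) (C d)) (F : β → ℕ∞ → ℝ≥0∞) :
    ∫⁻ ω, ∏ c ∈ s, F c (count ξ (C c) ω) ∂P =
      ∏ c ∈ s, ∫⁻ ω, F c (count ξ (C c) ω) ∂P := by
  have hind : iIndepFun (fun c : s => count ξ (C c)) P := by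
    have := h.indep s.card (fun k => C (s.equivFin.symm k)) (fun _ => hC _) (fun _ => hC' _)
      (fun k l hkl => hd fun e => hkl (s.equivFin.symm.injective (Subtype.ext e)))
    have h2 := this.precomp s.equivFin.injective
    simpa using h2
  have hm : ∀ c : s, AEMeasurable (fun ω => F c (count ξ (C c) ω)) P := fun c =>
    Measurable.of_discrete.comp_aemeasurable (h.law _ (hC c) (hC' c)).aemeasurable
  have hind2 : iIndepFun (fun (c : s) ω => F c (count ξ (C c) ω)) P :=
    hind.comp (fun c => F c) fun c => Measurable.of_discrete
  -- The law of a count provides only a.e. measurability, so measurable versions are used.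
  have hind3 : iIndepFun (fun c : s => (hm c).mk) P :=
    hind2.congr fun c => (hm c).ae_eq_mk
  have key := lintegral_prod_eq_prod_lintegral_of_indepFun Finset.univ _ hind3
    fun c => (hm c).measurable_mk
  simp_rw [← Finset.prod_coe_sort s]
  rw [Finset.prod_congr rfl fun c _ => lintegral_congr_ae (hm c).ae_eq_mk, ← key]
  refine lintegral_congr_ae ?_
  filter_upwards [ae_all_iff.2 fun c => (hm c).ae_eq_mk] with ω hω
  exact Finset.prod_congr rfl fun c _ => hω c

end Poisson

/-! ### Point configurations and kernels constant on the cells of a finite partition -/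

lemma setIntegral_simpleFunc {β : Type*} (q : SimpleFunc Plane β) {W : Set Plane}
    (hW' : volume W ≠ ⊤) (b : β → ℝ) :
    ∫ w in W, b (q w) = ∑ c ∈ q.range, volume.real (W ∩ q ⁻¹' {c}) * b c := by
  classical
  have : IsFiniteMeasure (volume.restrict W) := ⟨by simpa using hW'.lt_top⟩
  have h1 : ∀ w, b (q w) = ∑ c ∈ q.range, (q ⁻¹' {c}).indicator (fun _ => b c) w := by
    intro w
    rw [Finset.sum_eq_single (q w)]
    · simp
    · intro c _ hc
      simp [hc.symm]
    · simp
  simp_rw [h1]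
  rw [integral_finsetSum _ fun c _ => (integrable_const _).indicator (q.measurableSet_fiber c)]
  refine Finset.sum_congr rfl fun c _ => ?_
  rw [integral_indicator_const _ (q.measurableSet_fiber c),
    measureReal_restrict_apply (q.measurableSet_fiber c), smul_eq_mul, Set.inter_comm]

lemma setLIntegral_simpleFunc {β : Type*} (q : SimpleFunc Plane β) {W : Set Plane}
    (b : β → ℝ≥0∞) :
    ∫⁻ w in W, b (q w) = ∑ c ∈ q.range, b c * volume (W ∩ q ⁻¹' {c}) := by
  have : ∫⁻ w in W, b (q w) = ∫⁻ w in W, (q.map b) w := rfl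
  rw [this, SimpleFunc.lintegral_eq_lintegral, SimpleFunc.map_lintegral]
  refine Finset.sum_congr rfl fun c _ => ?_
  rw [Measure.restrict_apply (q.measurableSet_fiber c), Set.inter_comm]

section Configuration

variable {Ω ι β : Type*} {ξ : ι → Ω → Plane}

lemma toNat_count {A : Set Plane} {ω : Ω} (J : Finset ι) (hJ : ∀ i, i ∈ J ↔ ξ i ω ∈ A) :
    (count ξ A ω).toNat = J.card := by
  have : {i | ξ i ω ∈ A} = (J : Set ι) := by ext; simp [hJ]
  rw [count, this, Set.encard_coe_eq_coe_finsetCard, ENat.toNat_natCast]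

lemma toNat_count_cell [DecidableEq β] {W : Set Plane} {ω : Ω} (q : Plane → β) (J : Finset ι)
    (hJ : ∀ i, i ∈ J ↔ ξ i ω ∈ W) (c : β) :
    (count ξ (W ∩ q ⁻¹' {c}) ω).toNat = (J.filter fun i => q (ξ i ω) = c).card :=
  toNat_count _ fun i => by simp [hJ]

/-- Product of `u (xs i) (xs j)` over the indices `j ≠ i` of the points in the window `W`. -/
def others (W : Set Plane) (u : Plane → Plane → ℝ) (xs : ι → Plane) (i : ι) : ℝ≥0∞ :=
  open Classical in
  infProd fun j => if j ≠ i ∧ xs j ∈ W then ENNReal.ofReal (u (xs i) (xs j)) else 1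

/-- Sum over the points `x` of a configuration of `g x` times the product of `u x y` over the
other points `y` in the window `W`. -/
def pairSum (ξ : ι → Ω → Plane) (W : Set Plane) (g : Plane → ℝ≥0∞) (u : Plane → Plane → ℝ)
    (ω : Ω) : ℝ≥0∞ :=
  ∑' i, g (ξ i ω) * others W u (fun j => ξ j ω) i

lemma pairSum_eq_sum {W V : Set Plane} {g : Plane → ℝ≥0∞} {u : Plane → Plane → ℝ} {ω : Ω}
    (hg : ∀ z, z ∉ V → g z = 0) (J : Finset ι) (hJ : ∀ i, i ∈ J ↔ ξ i ω ∈ V) :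
    pairSum ξ W g u ω = ∑ i ∈ J, g (ξ i ω) * others W u (fun j => ξ j ω) i :=
  tsum_eq_sum fun i hi => by rw [hg _ fun h => hi ((hJ i).2 h), zero_mul]

/-- Supplies the integrable majorant for the dominated convergence arguments on pair sums. -/
lemma pairSum_le_count {W V : Set Plane} {g : Plane → ℝ≥0∞} {u : Plane → Plane → ℝ} {ω : Ω}
    (hg1 : ∀ z, g z ≤ 1) (hg : ∀ z, z ∉ V → g z = 0) (hfin : {i | ξ i ω ∈ V}.Finite) :
    pairSum ξ W g u ω ≤ (count ξ V ω).toNat := by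
  have hJ : ∀ i, i ∈ hfin.toFinset ↔ ξ i ω ∈ V := fun i => by simp
  rw [pairSum_eq_sum hg hfin.toFinset hJ, toNat_count hfin.toFinset hJ]
  refine (Finset.sum_le_card_nsmul _ _ 1 fun i _ => ?_).trans (by simp)
  exact mul_le_one' (hg1 _) infProd_le_one

lemma others_eq_prod {W : Set Plane} {u : Plane → Plane → ℝ} (hu : ∀ z w, u z w ≤ 1) {ω : Ω}
    [DecidableEq ι] (J : Finset ι) (hJ : ∀ i, i ∈ J ↔ ξ i ω ∈ W) (i : ι) :
    others W u (fun j => ξ j ω) i = ∏ j ∈ J.erase i, ENNReal.ofReal (u (ξ i ω) (ξ j ω)) := by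
  rw [others, infProd_eq_prod (J := J.erase i)]
  · refine Finset.prod_congr rfl fun j hj => ?_
    rw [Finset.mem_erase, hJ] at hj
    rw [if_pos hj]
  · intro j
    split_ifs
    · exact ENNReal.ofReal_le_one.2 (hu _ _)
    · exact le_rfl
  · intro j hj
    rw [Finset.mem_erase, hJ] at hj
    rw [if_neg hj]

lemma measurable_pairSum [MeasurableSpace Ω] [Countable ι] (hξ : ∀ i, Measurable (ξ i))
    {W : Set Plane} (hW : MeasurableSet W) {g : Plane → ℝ≥0∞} (hg : Measurable g)
    {u : Plane → Plane → ℝ} (hu : Measurable (Function.uncurry u)) :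
    Measurable (pairSum ξ W g u) := by
  classical
  refine Measurable.tsum fun i => (hg.comp (hξ i)).mul (measurable_infProd fun j => ?_)
  by_cases hij : j = i
  · simp [hij]
  · simp only [ne_eq, hij, not_false_eq_true, true_and]
    exact Measurable.ite (hξ j hW)
      (hu.comp ((hξ i).prodMk (hξ j))).ennreal_ofReal measurable_const

lemma measurable_simpleFunc_pair (q : SimpleFunc Plane β) (a : β → β → ℝ) :
    Measurable (Function.uncurry fun z w => a (q z) (q w)) :=
  (((q.comp Prod.fst measurable_fst).pair (q.comp Prod.snd measurable_snd)).map
    (Function.uncurry a)).measurable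

end Configuration

variable {Ω ι : Type*} [MeasurableSpace Ω] {P : Measure Ω} [IsProbabilityMeasure P] {lam : ℝ}
  {ξ : ι → Ω → Plane}

/-- The product depends only on the cell counts: it is `∏ a(c) ^ N_c`. The counts are independent,
so the expectation factors and the exponents add up to the integral. -/
lemma IsPoissonProcess.lintegral_infProd_simple (h : IsPoissonProcess P lam ξ) (hlam : 0 ≤ lam)
    {W : Set Plane} (hW : MeasurableSet W) (hW' : volume W ≠ ⊤)
    {β : Type*} (q : SimpleFunc Plane β) (a : β → ℝ) (ha : ∀ c, 0 ≤ a c) (ha1 : ∀ c, a c ≤ 1) :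
    ∫⁻ ω, (open Classical in
        infProd fun j => if ξ j ω ∈ W then ENNReal.ofReal (a (q (ξ j ω))) else 1) ∂P =
      ENNReal.ofReal (Real.exp (-(lam * ∫ w in W, (1 - a (q w))))) := by
  classical
  have hC : ∀ c, MeasurableSet (W ∩ q ⁻¹' {c}) := fun c => hW.inter (q.measurableSet_fiber c)
  have hC' : ∀ c, volume (W ∩ q ⁻¹' {c}) ≠ ⊤ := fun c =>
    measure_ne_top_of_subset Set.inter_subset_left hW'
  have hd : Pairwise fun c d => Disjoint (W ∩ q ⁻¹' {c}) (W ∩ q ⁻¹' {d}) := fun c d hcd =>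
    ((Set.disjoint_singleton.2 hcd).preimage q).mono Set.inter_subset_right Set.inter_subset_right
  have key : ∀ᵐ ω ∂P,
      (infProd fun j => if ξ j ω ∈ W then ENNReal.ofReal (a (q (ξ j ω))) else 1) =
        ∏ c ∈ q.range, ENNReal.ofReal (a c) ^ (count ξ (W ∩ q ⁻¹' {c}) ω).toNat := by
    filter_upwards [h.ae_finite hW hW'] with ω hω
    have hJ : ∀ i, i ∈ hω.toFinset ↔ ξ i ω ∈ W := fun i => by simp
    rw [infProd_eq_prod (J := hω.toFinset)]
    · rw [← Finset.prod_fiberwise_of_maps_to (g := fun i => q (ξ i ω)) (t := q.range)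
        fun i _ => q.mem_range_self _]
      refine Finset.prod_congr rfl fun c _ => ?_
      rw [toNat_count_cell q _ hJ, ← Finset.prod_const]
      refine Finset.prod_congr rfl fun j hj => ?_
      rw [Finset.mem_filter, hJ] at hj
      rw [if_pos hj.1, hj.2]
    · intro j
      split_ifs
      · exact ENNReal.ofReal_le_one.2 (ha1 _)
      · exact le_rfl
    · intro j hj
      rw [hJ] at hj
      rw [if_neg hj]
  rw [lintegral_congr_ae key, h.lintegral_prod_count q.range _ hC hC' hd
    (fun c n => ENNReal.ofReal (a c) ^ n.toNat),
    Finset.prod_congr rfl fun c _ => h.lintegral_pow_count hlam (hC c) (hC' c) (ha c),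
    ← ENNReal.ofReal_prod_of_nonneg fun c _ => (Real.exp_pos _).le, ← Real.exp_sum,
    setIntegral_simpleFunc q hW' fun c => 1 - a c, Finset.mul_sum, ← Finset.sum_neg_distrib]
  simp only [mul_assoc]

/-- Group the outer points by cell. Cell `c` contributes `g(c) N_c a(c,c) ^ (N_c - 1) ∏_{d ≠ c}
a(c,d) ^ N_d`, whose factors depend on independent counts. The expectation of the first one carries
`lam` times the area of `c`, and all the exponentials combine. -/
lemma IsPoissonProcess.lintegral_pairSum_simple (h : IsPoissonProcess P lam ξ) (hlam : 0 ≤ lam)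
    {W : Set Plane} (hW : MeasurableSet W) (hW' : volume W ≠ ⊤)
    {β : Type*} (q : SimpleFunc Plane β) (a : β → β → ℝ) (ha : ∀ c d, 0 ≤ a c d)
    (ha1 : ∀ c d, a c d ≤ 1) (g : β → ℝ≥0∞) (hg : ∀ z, z ∉ W → g (q z) = 0) :
    ∫⁻ ω, pairSum ξ W (fun z => g (q z)) (fun z w => a (q z) (q w)) ω ∂P =
      ∫⁻ z in W, g (q z) *
        ENNReal.ofReal (lam * Real.exp (-(lam * ∫ w in W, (1 - a (q z) (q w))))) := by
  classical
  have hC : ∀ c, MeasurableSet (W ∩ q ⁻¹' {c}) := fun c => hW.inter (q.measurableSet_fiber c)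
  have hC' : ∀ c, volume (W ∩ q ⁻¹' {c}) ≠ ⊤ := fun c =>
    measure_ne_top_of_subset Set.inter_subset_left hW'
  have hd : Pairwise fun c d => Disjoint (W ∩ q ⁻¹' {c}) (W ∩ q ⁻¹' {d}) := fun c d hcd =>
    ((Set.disjoint_singleton.2 hcd).preimage q).mono Set.inter_subset_right Set.inter_subset_right
  let F : β → β → ℕ∞ → ℝ≥0∞ := fun c d n =>
    if d = c then n.toNat * ENNReal.ofReal (a c c) ^ (n.toNat - 1)
    else ENNReal.ofReal (a c d) ^ n.toNat
  have key : ∀ᵐ ω ∂P, pairSum ξ W (fun z => g (q z)) (fun z w => a (q z) (q w)) ω =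
      ∑ c ∈ q.range, g c * ∏ d ∈ q.range, F c d (count ξ (W ∩ q ⁻¹' {d}) ω) := by
    filter_upwards [h.ae_finite hW hW'] with ω hω
    have hJ : ∀ i, i ∈ hω.toFinset ↔ ξ i ω ∈ W := fun i => by simp
    rw [pairSum_eq_sum hg _ hJ, ← Finset.sum_fiberwise_of_maps_to (g := fun i => q (ξ i ω))
      (t := q.range) fun i _ => q.mem_range_self _]
    refine Finset.sum_congr rfl fun c hc => ?_
    -- A point sees one point fewer in its own cell, since it is itself excluded.
    have hterm : ∀ i ∈ hω.toFinset.filter (fun i => q (ξ i ω) = c), g (q (ξ i ω)) *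
        others W (fun z w => a (q z) (q w)) (fun j => ξ j ω) i =
        g c * (ENNReal.ofReal (a c c) ^ ((count ξ (W ∩ q ⁻¹' {c}) ω).toNat - 1) *
          ∏ d ∈ q.range.erase c,
            ENNReal.ofReal (a c d) ^ (count ξ (W ∩ q ⁻¹' {d}) ω).toNat) := by
      intro i hi
      rw [Finset.mem_filter] at hi
      rw [others_eq_prod (u := fun z w => a (q z) (q w)) (fun _ _ => ha1 _ _) _ hJ, hi.2,
        ← Finset.prod_fiberwise_of_maps_to (g := fun i => q (ξ i ω)) (t := q.range)
        (fun i _ => q.mem_range_self _), ← Finset.mul_prod_erase _ _ hc]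
      congr 2
      · rw [toNat_count_cell q _ hJ, ← Finset.card_erase_of_mem (Finset.mem_filter.2 hi),
          ← Finset.prod_const, Finset.filter_erase]
        refine Finset.prod_congr rfl fun j hj => ?_
        rw [(Finset.mem_filter.1 (Finset.mem_of_mem_erase hj)).2]
      · refine Finset.prod_congr rfl fun d hd => ?_
        rw [toNat_count_cell q _ hJ, ← Finset.prod_const, Finset.filter_erase,
          Finset.erase_eq_of_notMem]
        · refine Finset.prod_congr rfl fun j hj => ?_
          rw [(Finset.mem_filter.1 hj).2]
        · intro hi'
          exact (Finset.mem_erase.1 hd).1 ((Finset.mem_filter.1 hi').2.symm.trans hi.2)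
    rw [Finset.sum_congr rfl hterm, Finset.sum_const, ← toNat_count_cell q _ hJ, nsmul_eq_mul,
      ← Finset.mul_prod_erase _ _ hc]
    have : ∀ d ∈ q.range.erase c, F c d (count ξ (W ∩ q ⁻¹' {d}) ω) =
        ENNReal.ofReal (a c d) ^ (count ξ (W ∩ q ⁻¹' {d}) ω).toNat := fun d hd =>
      if_neg (Finset.mem_erase.1 hd).1
    rw [Finset.prod_congr rfl this]
    simp only [F, if_true]
    ring
  have hm : ∀ c d, AEMeasurable (fun ω => F c d (count ξ (W ∩ q ⁻¹' {d}) ω)) P := fun c d =>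
    (Measurable.of_discrete (f := F c d)).comp_aemeasurable (h.law _ (hC d) (hC' d)).aemeasurable
  rw [lintegral_congr_ae key, lintegral_finsetSum' _ fun c _ =>
    (Finset.aemeasurable_fun_prod _ fun d _ => hm c d).const_mul _,
    setLIntegral_simpleFunc q (fun c => g c *
        ENNReal.ofReal (lam * Real.exp (-(lam * ∫ w in W, (1 - a c (q w))))))]
  refine Finset.sum_congr rfl fun c hc => ?_
  rw [lintegral_const_mul'' _ (Finset.aemeasurable_fun_prod _ fun d _ => hm c d),
    h.lintegral_prod_count q.range _ hC hC' hd, ← Finset.mul_prod_erase _ _ hc, mul_assoc]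
  congr 1
  have h1 : ∀ d ∈ q.range.erase c, ∫⁻ ω, F c d (count ξ (W ∩ q ⁻¹' {d}) ω) ∂P =
      ENNReal.ofReal (Real.exp (-(lam * volume.real (W ∩ q ⁻¹' {d}) * (1 - a c d)))) := by
    intro d hd
    simp only [F, if_neg (Finset.mem_erase.1 hd).1]
    exact h.lintegral_pow_count hlam (hC d) (hC' d) (ha c d)
  have h2 : ∫⁻ ω, F c c (count ξ (W ∩ q ⁻¹' {c}) ω) ∂P =
      ENNReal.ofReal (lam * volume.real (W ∩ q ⁻¹' {c}) *
        Real.exp (-(lam * volume.real (W ∩ q ⁻¹' {c}) * (1 - a c c)))) := by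
    simp only [F, if_true]
    exact h.lintegral_count_mul_pow hlam (hC c) (hC' c) (ha c c)
  rw [Finset.prod_congr rfl h1, h2, ← ENNReal.ofReal_prod_of_nonneg fun c _ => (Real.exp_pos _).le,
    ← ENNReal.ofReal_mul (by positivity), mul_assoc _ (Real.exp _),
    Finset.mul_prod_erase _
      (fun d => Real.exp (-(lam * volume.real (W ∩ q ⁻¹' {d}) * (1 - a c d)))) hc,
    ← Real.exp_sum, ← ENNReal.ofReal_toReal (hC' c), ← ENNReal.ofReal_mul (by positivity),
    setIntegral_simpleFunc q hW' fun d => 1 - a c d, Finset.mul_sum, ← Finset.sum_neg_distrib]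
  simp only [mul_assoc, measureReal_def]
  congr 2
  ring

/-! ### From simple kernels to general ones, and from windows to the plane -/

section Limits

variable {Ω ι : Type*} [MeasurableSpace Ω] {P : Measure Ω} [IsProbabilityMeasure P] {lam : ℝ}
  {ξ : ι → Ω → Plane}

/-- Probability generating functional in a window of finite area. -/
lemma IsPoissonProcess.lintegral_infProd_window [Countable ι] (h : IsPoissonProcess P lam ξ)
    (hlam : 0 ≤ lam) {W : Set Plane} (hW : MeasurableSet W) (hW' : volume W ≠ ⊤)
    {v : Plane → ℝ} (hv : Measurable v) (hv0 : ∀ z, 0 ≤ v z) (hv1 : ∀ z, v z ≤ 1) :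
    ∫⁻ ω, (open Classical in
        infProd fun j => if ξ j ω ∈ W then ENNReal.ofReal (v (ξ j ω)) else 1) ∂P =
      ENNReal.ofReal (Real.exp (-(lam * ∫ w in W, (1 - v w)))) := by
  classical
  have : IsFiniteMeasure (volume.restrict W) := ⟨by simpa using hW'.lt_top⟩
  have h0 : (0 : ℝ) ∈ Set.Icc (0 : ℝ) 1 := by simp
  let q := SimpleFunc.approxOn v hv (Set.Icc 0 1) 0 h0
  have hq : ∀ z, Tendsto (fun n => q n z) atTop (𝓝 (v z)) := fun z =>
    SimpleFunc.tendsto_approxOn hv h0 (subset_closure ⟨hv0 z, hv1 z⟩)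
  have hmem : ∀ n z, q n z ∈ Set.Icc (0 : ℝ) 1 := fun n z =>
    SimpleFunc.approxOn_mem hv h0 n z
  -- Clamping makes the weight lie in `[0, 1]` on all of `ℝ`; the values of `q n` lie there already
  -- and are unchanged.
  let a : ℝ → ℝ := fun r => max 0 (min r 1)
  have ha : ∀ n z, a (q n z) = q n z := fun n z => by
    simp [a, (hmem n z).1, (hmem n z).2]
  have hstep : ∀ n, ∫⁻ ω, (infProd fun j => if ξ j ω ∈ W then
        ENNReal.ofReal (q n (ξ j ω)) else 1) ∂P =
      ENNReal.ofReal (Real.exp (-(lam * ∫ w in W, (1 - q n w)))) := fun n => by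
    have := h.lintegral_infProd_simple hlam hW hW' (q n) a (fun _ => le_max_left _ _)
      (fun _ => max_le zero_le_one (min_le_right _ _))
    simpa only [ha] using this
  have hL : Tendsto (fun n => ∫⁻ ω, (infProd fun j => if ξ j ω ∈ W then
        ENNReal.ofReal (q n (ξ j ω)) else 1) ∂P) atTop
      (𝓝 (∫⁻ ω, (infProd fun j => if ξ j ω ∈ W then
        ENNReal.ofReal (v (ξ j ω)) else 1) ∂P)) := by
    refine tendsto_lintegral_of_dominated_convergence (fun _ => 1) (fun n => ?_)
      (fun n => ae_of_all _ fun ω => infProd_le_one) (by simp) ?_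
    · refine measurable_infProd fun j => Measurable.ite (h.measurable j hW) ?_ measurable_const
      exact ((q n).measurable.comp (h.measurable j)).ennreal_ofReal
    · filter_upwards [h.ae_finite hW hW'] with ω hω
      have hJ : ∀ (v : Plane → ℝ), (∀ z, v z ≤ 1) → (infProd fun j => if ξ j ω ∈ W then
          ENNReal.ofReal (v (ξ j ω)) else 1) =
          ∏ j ∈ hω.toFinset, if ξ j ω ∈ W then ENNReal.ofReal (v (ξ j ω)) else 1 := by
        intro v hv1
        refine infProd_eq_prod (fun j => ?_) (fun j hj => if_neg (by simpa using hj))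
        split_ifs
        · exact ENNReal.ofReal_le_one.2 (hv1 _)
        · exact le_rfl
      rw [hJ v hv1]
      simp_rw [fun n => hJ (q n) fun z => (hmem n z).2]
      refine ENNReal.tendsto_finsetProd_of_ne_top _ (fun j _ => ?_) (fun j _ => ?_)
      · split_ifs
        · exact ENNReal.tendsto_ofReal (hq _)
        · exact tendsto_const_nhds
      · split_ifs <;> simp
  refine tendsto_nhds_unique hL ?_
  simp_rw [hstep]
  refine ENNReal.tendsto_ofReal ((Real.continuous_exp.tendsto _).comp ?_)
  refine (Tendsto.const_mul lam ?_).neg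
  refine tendsto_integral_of_dominated_convergence (fun _ => 1) (fun n => ?_)
    (integrable_const _) (fun n => ae_of_all _ fun z => ?_)
    (ae_of_all _ fun z => tendsto_const_nhds.sub (hq z))
  · exact (measurable_const.sub (q n).measurable).aestronglyMeasurable
  · rw [Real.norm_eq_abs, abs_le]
    constructor <;> linarith [(hmem n z).1, (hmem n z).2]

/-- Probability generating functional of a Poisson process. -/
theorem IsPoissonProcess.lintegral_infProd [Countable ι] (h : IsPoissonProcess P lam ξ)
    (hlam : 0 ≤ lam) {v : Plane → ℝ} (hv : Measurable v) (hv0 : ∀ z, 0 ≤ v z)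
    (hv1 : ∀ z, v z ≤ 1) (hInt : Integrable fun w => 1 - v w) :
    ∫⁻ ω, (infProd fun j => ENNReal.ofReal (v (ξ j ω))) ∂P =
      ENNReal.ofReal (Real.exp (-(lam * ∫ w, (1 - v w)))) := by
  classical
  let W : ℕ → Set Plane := fun n => Metric.closedBall 0 n
  have hWm : Monotone W := fun m n hmn =>
    Metric.closedBall_subset_closedBall (by exact_mod_cast hmn)
  have hWu : ⋃ n, W n = Set.univ := Metric.iUnion_closedBall_nat 0
  let F : ℕ → Ω → ι → ℝ≥0∞ := fun n ω j =>
    if ξ j ω ∈ W n then ENNReal.ofReal (v (ξ j ω)) else 1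
  have hle1 : ∀ z, ENNReal.ofReal (v z) ≤ 1 := fun z => ENNReal.ofReal_le_one.2 (hv1 z)
  have hanti : ∀ ω j, Antitone fun n => F n ω j := by
    intro ω j m n hmn
    simp only [F]
    split_ifs with h1 h2 h2
    · exact le_rfl
    · exact hle1 _
    · exact absurd (hWm hmn h2) h1
    · exact le_rfl
  have hinf : ∀ ω, (infProd fun j => ENNReal.ofReal (v (ξ j ω))) = ⨅ n, infProd (F n ω) := by
    intro ω
    refine infProd_eq_iInf (hanti ω) (fun n j => ?_) fun j => ?_
    · simp only [F]
      split_ifs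
      · exact le_rfl
      · exact hle1 _
    · obtain ⟨n, hn⟩ := Set.mem_iUnion.1 (hWu ▸ Set.mem_univ (ξ j ω))
      exact ⟨n, if_pos hn⟩
  have hmF : ∀ n, Measurable fun ω => infProd (F n ω) := fun n =>
    measurable_infProd fun j => Measurable.ite (h.measurable j measurableSet_closedBall)
      (hv.comp (h.measurable j)).ennreal_ofReal measurable_const
  have hL : Tendsto (fun n => ∫⁻ ω, infProd (F n ω) ∂P) atTop
      (𝓝 (∫⁻ ω, (infProd fun j => ENNReal.ofReal (v (ξ j ω))) ∂P)) := by
    refine tendsto_lintegral_of_dominated_convergence (fun _ => 1) hmF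
      (fun n => ae_of_all _ fun ω => infProd_le_one) (by simp) (ae_of_all _ fun ω => ?_)
    rw [hinf ω]
    exact tendsto_atTop_iInf fun m n hmn => infProd_mono fun j => hanti ω j hmn
  refine tendsto_nhds_unique hL ?_
  simp_rw [F, fun n => h.lintegral_infProd_window hlam (W := W n) measurableSet_closedBall
    measure_closedBall_lt_top.ne hv hv0 hv1]
  refine ENNReal.tendsto_ofReal ((Real.continuous_exp.tendsto _).comp ?_)
  refine (Tendsto.const_mul lam ?_).neg
  have := tendsto_setIntegral_of_monotone (μ := volume) (f := fun w => 1 - v w) (s := W)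
    (fun n => measurableSet_closedBall) hWm hInt.integrableOn
  simpa [hWu] using this

/-- Multiplicative Campbell–Mecke formula in a window of finite area. -/
lemma IsPoissonProcess.lintegral_pairSum_window [Countable ι] (h : IsPoissonProcess P lam ξ)
    (hlam : 0 ≤ lam) {W : Set Plane} (hW : MeasurableSet W) (hW' : volume W ≠ ⊤)
    {β : Type*} (q : ℕ → SimpleFunc Plane β) (a : ℕ → β → β → ℝ) (ha : ∀ n c d, 0 ≤ a n c d)
    (ha1 : ∀ n c d, a n c d ≤ 1) (b : β → ℝ≥0∞) (g : Plane → ℝ≥0∞) (hg1 : ∀ z, g z ≤ 1)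
    (hg : ∀ z, z ∉ W → g z = 0) (hb : ∀ n z, b (q n z) = g z)
    (u : Plane → Plane → ℝ)
    (hu : ∀ z w, Tendsto (fun n => a n (q n z) (q n w)) atTop (𝓝 (u z w))) :
    ∫⁻ ω, pairSum ξ W g u ω ∂P =
      ∫⁻ z, g z * ENNReal.ofReal (lam * Real.exp (-(lam * ∫ w in W, (1 - u z w)))) := by
  classical
  have : IsFiniteMeasure (volume.restrict W) := ⟨by simpa using hW'.lt_top⟩
  have hu1 : ∀ z w, u z w ≤ 1 := fun z w => le_of_tendsto' (hu z w) fun n => ha1 _ _ _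
  have hgm : Measurable g := by
    have : g = (q 0).map b := by ext z; simp [hb]
    rw [this]; exact SimpleFunc.measurable _
  have hsupp : ∀ (f : Plane → ℝ≥0∞), ∫⁻ z in W, g z * f z = ∫⁻ z, g z * f z := fun f =>
    setLIntegral_eq_of_support_subset fun z hz => by
      by_contra hzW
      exact hz (by simp [hg z hzW])
  have hstep : ∀ n, ∫⁻ ω, pairSum ξ W g (fun z w => a n (q n z) (q n w)) ω ∂P =
      ∫⁻ z in W, g z * ENNReal.ofReal
        (lam * Real.exp (-(lam * ∫ w in W, (1 - a n (q n z) (q n w))))) := fun n => by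
    have := h.lintegral_pairSum_simple hlam hW hW' (q n) (a n) (ha n) (ha1 n) b
      (fun z hz => by rw [hb, hg z hz])
    simpa only [hb] using this
  have hL : Tendsto (fun n => ∫⁻ ω, pairSum ξ W g (fun z w => a n (q n z) (q n w)) ω ∂P) atTop
      (𝓝 (∫⁻ ω, pairSum ξ W g u ω ∂P)) := by
    refine tendsto_lintegral_of_dominated_convergence (fun ω => ((count ξ W ω).toNat : ℝ≥0∞))
      (fun n => measurable_pairSum h.measurable hW hgm (measurable_simpleFunc_pair _ _))
      (fun n => ?_) ?_ ?_
    · filter_upwards [h.ae_finite hW hW'] with ω hω using pairSum_le_count hg1 hg hω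
    -- With `a = 1` this is the mean number of points in `W`, which is finite.
    · have := h.lintegral_count_mul_pow hlam hW hW' zero_le_one
      simp only [ENNReal.ofReal_one, one_pow, mul_one] at this
      rw [this]
      exact ENNReal.ofReal_ne_top
    · filter_upwards [h.ae_finite hW hW'] with ω hω
      have hJ : ∀ i, i ∈ hω.toFinset ↔ ξ i ω ∈ W := fun i => by simp
      simp_rw [pairSum_eq_sum hg _ hJ]
      refine tendsto_finsetSum _ fun i _ => ?_
      refine ENNReal.Tendsto.const_mul ?_ (Or.inr ((hg1 _).trans_lt ENNReal.one_lt_top).ne)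
      rw [others_eq_prod hu1 _ hJ]
      simp_rw [fun n => others_eq_prod (u := fun z w => a n (q n z) (q n w))
        (fun z w => ha1 _ _ _) _ hJ]
      exact ENNReal.tendsto_finsetProd_of_ne_top _
        (fun j _ => ENNReal.tendsto_ofReal (hu _ _)) (fun j _ => ENNReal.ofReal_ne_top)
  refine tendsto_nhds_unique hL ?_
  simp_rw [hstep]
  rw [← hsupp]
  refine tendsto_lintegral_of_dominated_convergence (fun _ => ENNReal.ofReal lam)
    (fun n => ?_) (fun n => ae_of_all _ fun z => ?_) ?_ (ae_of_all _ fun z => ?_)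
  · exact hgm.mul ((q n).map fun c => ENNReal.ofReal
      (lam * Real.exp (-(lam * ∫ w in W, (1 - a n c (q n w)))))).measurable
  · refine (mul_le_mul' (hg1 z) (ENNReal.ofReal_le_ofReal ?_)).trans (one_mul _).le
    refine mul_le_of_le_one_right hlam (Real.exp_le_one_iff.2 (neg_nonpos.2 (mul_nonneg hlam ?_)))
    exact integral_nonneg fun w => sub_nonneg.2 (ha1 _ _ _)
  · simpa using ENNReal.mul_ne_top ENNReal.ofReal_ne_top hW'
  · refine ENNReal.Tendsto.const_mul ?_ (Or.inr ((hg1 _).trans_lt ENNReal.one_lt_top).ne)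
    refine ENNReal.tendsto_ofReal (Tendsto.const_mul lam ((Real.continuous_exp.tendsto _).comp ?_))
    refine (Tendsto.const_mul lam ?_).neg
    refine tendsto_integral_of_dominated_convergence (fun _ => 1) (fun n => ?_)
      (integrable_const _) (fun n => ae_of_all _ fun w => ?_)
      (ae_of_all _ fun w => tendsto_const_nhds.sub (hu z w))
    · exact ((q n).map fun d => 1 - a n (q n z) d).measurable.aestronglyMeasurable
    · rw [Real.norm_eq_abs, abs_le]
      constructor <;> linarith [ha n (q n z) (q n w), ha1 n (q n z) (q n w)]

end Limits

/-! ### Campbell–Mecke formula with the order by distance from the origin -/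

/-- Index of the ring of width `1 / n` containing a point, truncated at `n * n`. -/
def ringIndex (n : ℕ) : SimpleFunc Plane ℕ where
  toFun z := min ⌊n * ‖z‖⌋₊ (n * n)
  measurableSet_fiber' c := by
    have : Measurable fun z : Plane => min ⌊n * ‖z‖⌋₊ (n * n) :=
      (Nat.measurable_floor.comp (measurable_norm.const_mul _)).min measurable_const
    exact this (measurableSet_singleton c)
  finite_range' := (Set.finite_Iic (n * n)).subset (by
    rintro _ ⟨z, rfl⟩
    exact min_le_right (⌊n * ‖z‖⌋₊) (n * n))

lemma ringIndex_apply (n : ℕ) (z : Plane) : ringIndex n z = min ⌊n * ‖z‖⌋₊ (n * n) := rfl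

lemma ringIndex_mono (n : ℕ) {z w : Plane} (h : ‖z‖ ≤ ‖w‖) : ringIndex n z ≤ ringIndex n w :=
  min_le_min_right _ (Nat.floor_le_floor (by gcongr))

/-- Once `n` times the gap is at least `1` the two points lie in different rings, and `n > ‖z‖`
keeps `z` below the truncation. With `ringIndex_mono`, comparing ring indices converges at every
pair, ties included, to the discontinuous comparison `‖z‖ < ‖w‖`. -/
lemma eventually_ringIndex_lt {z w : Plane} (h : ‖z‖ < ‖w‖) :
    ∀ᶠ n in atTop, ringIndex n z < ringIndex n w := by
  have h1 : ∀ᶠ n : ℕ in atTop, ‖z‖ < n := tendsto_natCast_atTop_atTop.eventually_gt_atTop _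
  have h2 : ∀ᶠ n : ℕ in atTop, 1 / (‖w‖ - ‖z‖) ≤ n :=
    tendsto_natCast_atTop_atTop.eventually_ge_atTop _
  filter_upwards [h1, h2] with n h1 h2
  rw [div_le_iff₀ (sub_pos.2 h)] at h2
  have hn : (0 : ℝ) < n := (norm_nonneg z).trans_lt h1
  have hz : ⌊n * ‖z‖⌋₊ < n * n := by
    rw [Nat.floor_lt (by positivity)]
    push_cast
    gcongr
  have hw : ⌊n * ‖z‖⌋₊ + 1 ≤ ⌊n * ‖w‖⌋₊ := by
    rw [← Nat.floor_add_one (by positivity)]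
    exact Nat.floor_le_floor (by linarith)
  rw [ringIndex_apply, ringIndex_apply, min_eq_left hz.le]
  exact lt_min hw hz

/-- The kernel `k`, cut off to the pairs whose second point is farther from the origin. -/
def farther (k : Plane → Plane → ℝ) (z w : Plane) : ℝ := if ‖z‖ < ‖w‖ then k z w else 0

lemma measurable_farther {k : Plane → Plane → ℝ} (hk : Measurable (Function.uncurry k)) :
    Measurable (Function.uncurry (farther k)) :=
  Measurable.ite (measurableSet_lt measurable_fst.norm measurable_snd.norm) hk measurable_const

lemma farther_le_one {k : Plane → Plane → ℝ} (hk1 : ∀ z w, k z w ≤ 1) (z w : Plane) :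
    farther k z w ≤ 1 := by
  rw [farther]
  split_ifs
  exacts [hk1 z w, zero_le_one]

lemma tsum_iSup_of_monotone {ι : Type*} {f : ℕ → ι → ℝ≥0∞} (hf : Monotone f) :
    ∑' i, ⨆ n, f n i = ⨆ n, ∑' i, f n i := by
  let : MeasurableSpace ι := ⊤
  have : MeasurableSingletonClass ι := ⟨fun _ => trivial⟩
  simpa only [lintegral_count] using
    lintegral_iSup (μ := Measure.count) (fun n => measurable_from_top (f := f n)) hf

section Mecke

variable {Ω ι : Type*} [MeasurableSpace Ω] {P : Measure Ω} [IsProbabilityMeasure P] {lam : ℝ}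
  {ξ : ι → Ω → Plane} [Countable ι]

/-- The cells record three data: an approximate position, which suffices for the continuous `k`; the
ring index, which approximates the order of norms; and membership in `A`, which is kept exactly. -/
lemma IsPoissonProcess.lintegral_pairSum_farther_window (h : IsPoissonProcess P lam ξ)
    (hlam : 0 ≤ lam) {W A : Set Plane} (hW : MeasurableSet W) (hW' : volume W ≠ ⊤)
    (hA : MeasurableSet A) (hAW : A ⊆ W) {k : Plane → Plane → ℝ}
    (hk : Continuous (Function.uncurry k)) (hk0 : ∀ z w, 0 ≤ k z w) (hk1 : ∀ z w, k z w ≤ 1) :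
    ∫⁻ ω, pairSum ξ W (A.indicator 1) (farther k) ω ∂P =
      ∫⁻ z in A, ENNReal.ofReal (lam * Real.exp (-(lam * ∫ w in W, (1 - farther k z w)))) := by
  classical
  let id' := (stronglyMeasurable_id (α := Plane)).approx
  have hid : ∀ z, Tendsto (fun n => id' n z) atTop (𝓝 z) :=
    (stronglyMeasurable_id (α := Plane)).tendsto_approx
  let ind : SimpleFunc Plane ℝ≥0∞ := SimpleFunc.piecewise A hA 1 0
  have hind : ∀ z, ind z = A.indicator 1 z := fun z => by
    simp [ind, SimpleFunc.coe_piecewise, Set.indicator, Set.piecewise]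
  have := h.lintegral_pairSum_window hlam hW hW' (fun n => (id' n).pair ((ringIndex n).pair ind))
    (fun n c d => if c.2.1 < d.2.1 then k c.1 d.1 else 0)
    (fun n c d => by split_ifs; exacts [hk0 _ _, le_rfl])
    (fun n c d => by split_ifs; exacts [hk1 _ _, zero_le_one])
    (fun c => c.2.2) (A.indicator 1) (Set.indicator_le_self' (by simp))
    (fun z hz => Set.indicator_of_notMem (fun hzA => hz (hAW hzA)) _)
    (fun n z => hind z) (farther k) ?_
  · rw [this, ← lintegral_indicator hA]
    refine lintegral_congr fun z => ?_
    by_cases hz : z ∈ A <;> simp [hz]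
  · intro z w
    simp only [SimpleFunc.pair_apply, farther]
    split_ifs with hzw
    · have hlim : Tendsto (fun n => k (id' n z) (id' n w)) atTop (𝓝 (k z w)) :=
        (hk.tendsto (z, w)).comp ((hid z).prodMk_nhds (hid w))
      refine hlim.congr' ?_
      filter_upwards [eventually_ringIndex_lt hzw] with n hn
      exact (if_pos hn).symm
    · refine tendsto_const_nhds.congr fun n => ?_
      exact (if_neg (ringIndex_mono n (not_lt.1 hzw)).not_gt).symm

/-- Multiplicative Campbell–Mecke formula for products over the points farther from the origin. -/
theorem IsPoissonProcess.lintegral_pairSum_farther (h : IsPoissonProcess P lam ξ)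
    (hlam : 0 ≤ lam) {A : Set Plane} (hA : MeasurableSet A) {k : Plane → Plane → ℝ}
    (hk : Continuous (Function.uncurry k)) (hk0 : ∀ z w, 0 ≤ k z w) (hk1 : ∀ z w, k z w ≤ 1)
    (hInt : ∀ z, Integrable fun w => 1 - farther k z w) :
    ∫⁻ ω, pairSum ξ Set.univ (A.indicator 1) (farther k) ω ∂P =
      ∫⁻ z in A, ENNReal.ofReal (lam * Real.exp (-(lam * ∫ w, (1 - farther k z w)))) := by
  classical
  let W : ℕ → Set Plane := fun n => Metric.closedBall 0 n
  have hWm : Monotone W := fun m n hmn =>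
    Metric.closedBall_subset_closedBall (by exact_mod_cast hmn)
  have hWu : ⋃ n, W n = Set.univ := Metric.iUnion_closedBall_nat 0
  have hWms : ∀ n, MeasurableSet (W n) := fun n => measurableSet_closedBall
  have hWf : ∀ n, volume (W n) ≠ ⊤ := fun n => measure_closedBall_lt_top.ne
  have hu := measurable_farther hk.measurable
  have hle1 : ∀ z w, ENNReal.ofReal (farther k z w) ≤ 1 := fun z w =>
    ENNReal.ofReal_le_one.2 (farther_le_one hk1 z w)
  -- The outer points stay in the fixed disc `W K`, whose count dominates, while the window of the
  -- other points grows.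
  have hbdd : ∀ K : ℕ, ∫⁻ ω, pairSum ξ Set.univ ((A ∩ W K).indicator 1) (farther k) ω ∂P =
      ∫⁻ z in A ∩ W K,
        ENNReal.ofReal (lam * Real.exp (-(lam * ∫ w, (1 - farther k z w)))) := by
    intro K
    have hAK : MeasurableSet (A ∩ W K) := hA.inter (hWms K)
    have hg1 : ∀ z, (A ∩ W K).indicator (1 : Plane → ℝ≥0∞) z ≤ 1 :=
      Set.indicator_le_self' (by simp)
    have hg : ∀ z, z ∉ W K → (A ∩ W K).indicator (1 : Plane → ℝ≥0∞) z = 0 :=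
      fun z hz => Set.indicator_of_notMem (fun hzA => hz hzA.2) _
    have hL : Tendsto (fun n => ∫⁻ ω, pairSum ξ (W n) ((A ∩ W K).indicator 1) (farther k) ω ∂P)
        atTop (𝓝 (∫⁻ ω, pairSum ξ Set.univ ((A ∩ W K).indicator 1) (farther k) ω ∂P)) := by
      refine tendsto_lintegral_of_dominated_convergence
        (fun ω => ((count ξ (W K) ω).toNat : ℝ≥0∞))
        (fun n => measurable_pairSum h.measurable (hWms n) (measurable_one.indicator hAK) hu)
        (fun n => ?_) ?_ ?_
      · filter_upwards [h.ae_finite (hWms K) (hWf K)] with ω hω using pairSum_le_count hg1 hg hω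
      · have := h.lintegral_count_mul_pow hlam (hWms K) (hWf K) zero_le_one
        simp only [ENNReal.ofReal_one, one_pow, mul_one] at this
        rw [this]
        exact ENNReal.ofReal_ne_top
      · filter_upwards [h.ae_finite (hWms K) (hWf K)] with ω hω
        have hJ : ∀ i, i ∈ hω.toFinset ↔ ξ i ω ∈ W K := fun i => by simp
        simp_rw [pairSum_eq_sum hg _ hJ]
        refine tendsto_finsetSum _ fun i _ => ?_
        refine ENNReal.Tendsto.const_mul ?_ (Or.inr ((hg1 _).trans_lt ENNReal.one_lt_top).ne)
        have hanti : ∀ j, Antitone fun n => if j ≠ i ∧ ξ j ω ∈ W n then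
            ENNReal.ofReal (farther k (ξ i ω) (ξ j ω)) else 1 := by
          intro j m n hmn
          dsimp only
          split_ifs with h1 h2 h2
          · exact le_rfl
          · exact hle1 _ _
          · exact absurd ⟨h2.1, hWm hmn h2.2⟩ h1
          · exact le_rfl
        rw [others, infProd_eq_iInf hanti]
        · exact tendsto_atTop_iInf fun m n hmn => infProd_mono fun j => hanti j hmn
        · intro n j
          by_cases hji : j = i
          · simp [hji]
          · by_cases hj : ξ j ω ∈ W n <;> simp [hji, hj, farther_le_one hk1]
        · intro j
          obtain ⟨n, hn⟩ := Set.mem_iUnion.1 (hWu ▸ Set.mem_univ (ξ j ω))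
          exact ⟨n, by simp [hn]⟩
    have hR : Tendsto (fun n => ∫⁻ z in A ∩ W K, ENNReal.ofReal
          (lam * Real.exp (-(lam * ∫ w in W n, (1 - farther k z w))))) atTop
        (𝓝 (∫⁻ z in A ∩ W K,
          ENNReal.ofReal (lam * Real.exp (-(lam * ∫ w, (1 - farther k z w)))))) := by
      refine tendsto_lintegral_of_dominated_convergence (fun _ => ENNReal.ofReal lam)
        (fun n => ?_) (fun n => ae_of_all _ fun z => ?_) ?_ (ae_of_all _ fun z => ?_)
      · have hm : StronglyMeasurable (Function.uncurry fun z w => 1 - farther k z w) :=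
          (measurable_const.sub hu).stronglyMeasurable
        exact ((hm.integral_prod_right (ν := volume.restrict (W n))).measurable.const_mul
          lam).neg.exp.const_mul lam |>.ennreal_ofReal
      · refine ENNReal.ofReal_le_ofReal (mul_le_of_le_one_right hlam
          (Real.exp_le_one_iff.2 (neg_nonpos.2 (mul_nonneg hlam ?_))))
        exact integral_nonneg fun w => sub_nonneg.2 (farther_le_one hk1 _ _)
      · have : volume (A ∩ W K) ≠ ⊤ := measure_ne_top_of_subset Set.inter_subset_right (hWf K)
        simpa using ENNReal.mul_ne_top ENNReal.ofReal_ne_top this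
      · refine ENNReal.tendsto_ofReal
          (Tendsto.const_mul lam ((Real.continuous_exp.tendsto _).comp ?_))
        refine (Tendsto.const_mul lam ?_).neg
        have := tendsto_setIntegral_of_monotone (μ := volume) (s := W)
          (f := fun w => 1 - farther k z w) hWms hWm (hInt z).integrableOn
        simpa [hWu] using this
    refine tendsto_nhds_unique hL (hR.congr' ?_)
    filter_upwards [eventually_ge_atTop K] with n hn
    exact (h.lintegral_pairSum_farther_window hlam (hWms n) (hWf n) hAK
      (Set.inter_subset_right.trans (hWm hn)) hk hk0 hk1).symm
  -- The restriction on the outer points is now lifted by monotone convergence in `K`.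
  have hgm : Monotone fun K => (A ∩ W K).indicator (1 : Plane → ℝ≥0∞) := fun m n hmn =>
    Set.indicator_le_indicator_of_subset (Set.inter_subset_inter_right A (hWm hmn)) (by simp)
  have hgsup : ∀ z, A.indicator (1 : Plane → ℝ≥0∞) z = ⨆ K, (A ∩ W K).indicator 1 z := by
    intro z
    refine le_antisymm ?_ (iSup_le fun K =>
      Set.indicator_le_indicator_of_subset Set.inter_subset_left (by simp) z)
    obtain ⟨K, hK⟩ := Set.mem_iUnion.1 (hWu ▸ Set.mem_univ z)
    refine le_iSup_of_le K ?_
    by_cases hz : z ∈ A <;> simp [hz, hK]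
  have hpair : ∀ ω, pairSum ξ Set.univ (A.indicator 1) (farther k) ω =
      ⨆ K, pairSum ξ Set.univ ((A ∩ W K).indicator 1) (farther k) ω := by
    intro ω
    simp only [pairSum, hgsup, ENNReal.iSup_mul]
    exact tsum_iSup_of_monotone fun m n hmn i => mul_le_mul_left (hgm hmn _) _
  simp_rw [hpair]
  rw [lintegral_iSup]
  · simp_rw [hbdd]
    rw [← setLIntegral_iUnion_of_directed, ← Set.inter_iUnion, hWu, Set.inter_univ]
    exact directed_of_isDirected_le fun m n hmn => Set.inter_subset_inter_right A (hWm hmn)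
  · exact fun K => measurable_pairSum h.measurable .univ
      (measurable_one.indicator (hA.inter (hWms K))) hu
  · exact fun m n hmn ω => ENNReal.tsum_le_tsum fun i => mul_le_mul_left (hgm hmn _) _

end Mecke

/-! ### Polar coordinates -/

lemma integral_norm_plane (f : ℝ → ℝ) :
    ∫ z : Plane, f ‖z‖ = ∫ r in Set.Ioi (0 : ℝ), 2 * Real.pi * r * f r := by
  rw [integral_fun_norm_addHaar, measureReal_def, EuclideanSpace.volume_ball_fin_two]
  simp only [finrank_euclideanSpace, Fintype.card_fin, Nat.add_one_sub_one, pow_one, nsmul_eq_mul,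
    smul_eq_mul]
  rw [← integral_const_mul, ← integral_const_mul]
  refine setIntegral_congr_fun measurableSet_Ioi fun r _ => ?_
  simp [Real.pi_pos.le]
  ring

lemma integrable_norm_plane {f : ℝ → ℝ} :
    Integrable (fun z : Plane => f ‖z‖) ↔ IntegrableOn (fun r => r * f r) (Set.Ioi 0) := by
  rw [integrable_fun_norm_addHaar]
  simp

lemma lintegral_norm_plane {f : ℝ → ℝ} (hf : ∀ r, 0 ≤ f r)
    (hInt : IntegrableOn (fun r => r * f r) (Set.Ioi 0)) :
    ∫⁻ z : Plane, ENNReal.ofReal (f ‖z‖) =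
      ∫⁻ r in Set.Ioi (0 : ℝ), ENNReal.ofReal (2 * Real.pi * r * f r) := by
  rw [← ofReal_integral_eq_lintegral_ofReal (integrable_norm_plane.2 hInt)
    (ae_of_all _ fun z => hf _), integral_norm_plane, ofReal_integral_eq_lintegral_ofReal]
  · simpa only [mul_assoc] using (hInt.const_mul Real.pi).const_mul 2
  · refine (ae_restrict_iff' measurableSet_Ioi).2 (ae_of_all _ fun r (hr : 0 < r) => ?_)
    have := hf r
    have := Real.pi_pos
    positivity

/-! ### Path loss, detection probabilities and the mean counts -/

namespace Params

variable (p : Params)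

/-- Probability that a signal sent over the displacement `w` with exponential fading is received
above the relative threshold `θ`. -/
def detect (θ : ℝ) (w : Plane) : ℝ := Real.exp (-p.μ * θ * p.pathLoss ‖w‖)

variable {p} {θ : ℝ}

lemma pathLoss_pos {d : ℝ} (hd : 0 < d) : 0 < p.pathLoss d := by
  have := p.wavelength_pos
  have := Real.pi_pos
  unfold pathLoss
  positivity

lemma pathLoss_nonneg {d : ℝ} (hd : 0 ≤ d) : 0 ≤ p.pathLoss d := by
  unfold pathLoss
  positivity

lemma continuous_pathLoss : Continuous p.pathLoss :=
  continuous_const.mul (Real.continuous_rpow_const p.α_pos.le)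

lemma detect_pos (w : Plane) : 0 < p.detect θ w := Real.exp_pos _

lemma detect_le_one (hθ : 0 < θ) (w : Plane) : p.detect θ w ≤ 1 := by
  refine Real.exp_le_one_iff.2 ?_
  have := p.μ_pos
  have := pathLoss_nonneg (p := p) (norm_nonneg w)
  have : 0 ≤ p.μ * θ * p.pathLoss ‖w‖ := by positivity
  linarith

lemma continuous_detect : Continuous (p.detect θ) :=
  Real.continuous_exp.comp (continuous_const.mul (continuous_pathLoss.comp continuous_norm))

/-- In polar coordinates this is the convergence of `∫ r exp (-c r ^ α) dr` for `c, α > 0`. -/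
lemma integrable_detect (hθ : 0 < θ) : Integrable (p.detect θ) := by
  have hc : 0 < p.μ * θ * (4 * Real.pi / p.wavelength) ^ 2 := by
    have := p.wavelength_pos
    have := Real.pi_pos
    have := p.μ_pos
    positivity
  refine integrable_norm_plane (f := fun d => Real.exp (-p.μ * θ * p.pathLoss d)).2 ?_
  refine (integrableOn_rpow_mul_exp_neg_mul_rpow (s := 1) (by norm_num) p.α_pos hc).congr_fun
    (fun r _ => ?_) measurableSet_Ioi
  simp only [Real.rpow_one, pathLoss]
  ring_nf

lemma integrable_detect_sub (hθ : 0 < θ) (z : Plane) : Integrable fun w => p.detect θ (w - z) :=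
  (integrable_detect hθ).comp_sub_right z

/-- The reflection exchanging `z` and `(‖z‖, 0)` preserves area, norms and centred discs. Hence the
mean count seen from `z` depends only on `‖z‖`. -/
lemma integral_detect_compl_closedBall (z : Plane) :
    ∫ w in (Metric.closedBall (0 : Plane) ‖z‖)ᶜ, p.detect θ (w - z) =
      ∫ w in (Metric.closedBall (0 : Plane) ‖z‖)ᶜ, p.detect θ (w - !₂[‖z‖, 0]) := by
  have hnorm : ‖z‖ = ‖(!₂[‖z‖, 0] : Plane)‖ := by
    simp [EuclideanSpace.norm_eq, Fin.sum_univ_two]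
  let R : Plane ≃ₗᵢ[ℝ] Plane := (ℝ ∙ (z - !₂[‖z‖, 0]))ᗮ.reflection
  have hR : R z = !₂[‖z‖, 0] := Submodule.reflection_sub hnorm
  have hpre : R ⁻¹' (Metric.closedBall (0 : Plane) ‖z‖)ᶜ = (Metric.closedBall 0 ‖z‖)ᶜ := by
    ext w; simp
  rw [← R.measurePreserving.setIntegral_preimage_emb R.toHomeomorph.measurableEmbedding, hpre]
  refine setIntegral_congr_fun measurableSet_closedBall.compl fun w _ => ?_
  have hR' : R !₂[‖z‖, 0] = z := by rw [← hR]; exact Submodule.reflection_reflection _ z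
  have : R w - z = R (w - !₂[‖z‖, 0]) := by rw [map_sub, hR']
  simp only [detect]
  rw [this, R.norm_map]

lemma NW2_norm (z : Plane) : p.NW2 ‖z‖ =
    p.lamW * ∫ w in (Metric.closedBall (0 : Plane) ‖z‖)ᶜ, p.detect (p.Γcs / p.PW) (w - z) := by
  rw [integral_detect_compl_closedBall]
  rfl

lemma NL_eq : p.NL = p.lamL * ∫ w, p.detect (p.Γed / p.PL) w := by
  -- The disc of radius `0` is a single point, so removing it does not change the integral.
  have : (({0} : Set Plane)ᶜ : Set Plane) =ᵐ[volume] Set.univ := by simp [ae_eq_univ]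
  rw [NL, NL0, Metric.closedBall_zero, setIntegral_congr_set this, setIntegral_univ]
  simp [detect]

lemma Γcs_div_pos : 0 < p.Γcs / p.PW := div_pos p.Γcs_pos p.PW_pos

lemma Γed_div_pos : 0 < p.Γed / p.PL := div_pos p.Γed_pos p.PL_pos

/-- Makes the division by `N_2^W` genuine: the integrand is positive everywhere and the complement
of a disc is open and nonempty. -/
lemma NW2_pos (r : ℝ) : 0 < p.NW2 r := by
  refine mul_pos p.lamW_pos ?_
  have hInt := (integrable_detect_sub (p := p) (Γcs_div_pos (p := p)) (!₂[r, 0])).integrableOn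
    (s := (Metric.closedBall (0 : Plane) r)ᶜ)
  refine (setIntegral_pos_iff_support_of_nonneg_ae (ae_of_all _ fun w => (detect_pos _).le)
    hInt).2 ?_
  have : (Function.support fun w => p.detect (p.Γcs / p.PW) (w - !₂[r, 0])) = Set.univ := by
    ext w; simp [(detect_pos _).ne']
  rw [this, Set.univ_inter]
  have hopen : IsOpen (Metric.closedBall (0 : Plane) r)ᶜ := Metric.isClosed_closedBall.isOpen_compl
  refine hopen.measure_pos _ ?_
  obtain ⟨w, hw⟩ := NormedSpace.exists_lt_norm ℝ Plane r
  exact ⟨w, by simpa using hw⟩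

lemma measurable_NW2 : Measurable p.NW2 := by
  have h1 : ∀ r, p.NW2 r = p.lamW * ∫ w : Plane, {q : ℝ × Plane | q.1 < ‖q.2‖}.indicator
      (fun q => p.detect (p.Γcs / p.PW) (q.2 - !₂[q.1, 0])) (r, w) := by
    intro r
    rw [NW2, NW0, ← integral_indicator measurableSet_closedBall.compl]
    congr 2 with w
    simp [Set.indicator, detect]
  have hc : Continuous fun r : ℝ => (!₂[r, 0] : Plane) := by fun_prop
  have hm : StronglyMeasurable ({q : ℝ × Plane | q.1 < ‖q.2‖}.indicator
      (fun q => p.detect (p.Γcs / p.PW) (q.2 - !₂[q.1, 0]))) := by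
    refine (Measurable.indicator ?_ (measurableSet_lt measurable_fst
      measurable_snd.norm)).stronglyMeasurable
    exact (continuous_detect.comp
      (continuous_snd.sub (hc.comp continuous_fst))).measurable
  rw [funext h1]
  exact (hm.integral_prod_right' (ν := volume)).measurable.const_mul _

/-- Probability that an AP at `w` does not silence the AP at `z` whose timer is `s`. -/
def quiet (p : Params) (s : ℝ) (z w : Plane) : ℝ := 1 - s * p.detect (p.Γcs / p.PW) (w - z)

lemma continuous_quiet (s : ℝ) : Continuous (Function.uncurry (p.quiet s)) :=
  continuous_const.sub (continuous_const.mul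
    (continuous_detect.comp (continuous_snd.sub continuous_fst)))

lemma quiet_nonneg {s : ℝ} (hs : s ∈ Set.Icc (0 : ℝ) 1) (z w : Plane) : 0 ≤ p.quiet s z w := by
  have := mul_le_one₀ hs.2 (detect_pos (p := p) (θ := p.Γcs / p.PW) (w - z)).le
    (detect_le_one Γcs_div_pos _)
  exact sub_nonneg.2 this

lemma quiet_le_one {s : ℝ} (hs : s ∈ Set.Icc (0 : ℝ) 1) (z w : Plane) : p.quiet s z w ≤ 1 :=
  sub_le_self _ (mul_nonneg hs.1 (detect_pos _).le)

/-- Points in the disc are forbidden outright; a point outside it is forbidden with probability `s`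
times its detection probability. The two terms integrate to the void exponent and to `s N_2^W`. -/
lemma one_sub_farther_quiet (s : ℝ) (z w : Plane) : 1 - farther (p.quiet s) z w =
    (Metric.closedBall (0 : Plane) ‖z‖).indicator (fun _ => (1 : ℝ)) w +
      s * (Metric.closedBall (0 : Plane) ‖z‖)ᶜ.indicator
        (fun w => p.detect (p.Γcs / p.PW) (w - z)) w := by
  by_cases h : ‖z‖ < ‖w‖
  · simp [farther, quiet, h, Set.indicator, not_le.2 h]
  · simp [farther, h, Set.indicator, not_lt.1 h]

lemma integrable_one_sub_farther_quiet (s : ℝ) (z : Plane) :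
    Integrable fun w => 1 - farther (p.quiet s) z w := by
  simp_rw [one_sub_farther_quiet]
  refine Integrable.add ?_ (Integrable.const_mul ?_ s)
  · exact (integrable_indicator_iff measurableSet_closedBall).2
      (integrableOn_const measure_closedBall_lt_top.ne)
  · exact (integrable_detect_sub Γcs_div_pos z).indicator measurableSet_closedBall.compl

lemma integral_one_sub_farther_quiet (s : ℝ) (z : Plane) :
    p.lamW * ∫ w, (1 - farther (p.quiet s) z w) =
      p.lamW * Real.pi * ‖z‖ ^ 2 + s * p.NW2 ‖z‖ := by
  simp_rw [one_sub_farther_quiet]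
  rw [integral_add, integral_const_mul, integral_indicator measurableSet_closedBall.compl,
    integral_indicator measurableSet_closedBall, NW2_norm]
  · rw [setIntegral_const, measureReal_def, EuclideanSpace.volume_closedBall_fin_two]
    simp [Real.pi_pos.le]
    ring
  · exact (integrable_indicator_iff measurableSet_closedBall).2
      (integrableOn_const measure_closedBall_lt_top.ne)
  · exact ((integrable_detect_sub Γcs_div_pos z).indicator
      measurableSet_closedBall.compl).const_mul s

lemma fW_nonneg {r : ℝ} (hr : 0 ≤ r) : 0 ≤ p.fW r := by
  have := p.lamW_pos
  have := Real.pi_pos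
  unfold fW
  positivity

lemma continuous_fW : Continuous p.fW := by
  unfold fW
  fun_prop

lemma integrableOn_fW : IntegrableOn p.fW (Set.Ioi 0) := by
  have hb : 0 < p.lamW * Real.pi := mul_pos p.lamW_pos Real.pi_pos
  have := (integrableOn_rpow_mul_exp_neg_mul_rpow (s := 1) (p := 2) (by norm_num) two_pos hb)
  refine IntegrableOn.congr_fun (this.const_mul (p.lamW * (2 * Real.pi)))
    (fun r _ => ?_) measurableSet_Ioi
  simp only [Real.rpow_one, Real.rpow_two, fW]
  ring_nf

/-- Polar coordinates for the void probability of a disc. -/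
lemma lintegral_void_mul {F : ℝ → ℝ} (hF : Measurable F) (hF0 : ∀ r, 0 ≤ F r)
    (hF1 : ∀ r, F r ≤ 1) :
    ∫⁻ z : Plane, ENNReal.ofReal
        (p.lamW * Real.exp (-(p.lamW * Real.pi * ‖z‖ ^ 2)) * F ‖z‖) =
      ∫⁻ r in Set.Ioi (0 : ℝ), ENNReal.ofReal (p.fW r * F r) := by
  have hlam := p.lamW_pos
  have hfe : ∀ r, p.fW r = 2 * Real.pi * (r * (p.lamW *
      Real.exp (-(p.lamW * Real.pi * r ^ 2)))) := fun r => by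
    simp only [fW]
    ring_nf
  have hInt : IntegrableOn (fun r => r * (p.lamW * Real.exp (-(p.lamW * Real.pi * r ^ 2)) * F r))
      (Set.Ioi 0) := by
    have h1 : IntegrableOn (fun r => (2 * Real.pi)⁻¹ * p.fW r) (Set.Ioi 0) :=
      integrableOn_fW.const_mul _
    refine h1.mono' (by fun_prop) ?_
    refine (ae_restrict_iff' measurableSet_Ioi).2 (ae_of_all _ fun r (hr : 0 < r) => ?_)
    rw [hfe, inv_mul_cancel_left₀ (by positivity), Real.norm_of_nonneg
      (by have := hF0 r; positivity), ← mul_assoc]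
    exact mul_le_of_le_one_right (by positivity) (hF1 r)
  rw [lintegral_norm_plane (f := fun r =>
    p.lamW * Real.exp (-(p.lamW * Real.pi * r ^ 2)) * F r)
    (fun r => mul_nonneg (by positivity) (hF0 r)) hInt]
  refine lintegral_congr fun r => ?_
  rw [hfe]
  ring_nf

end Params

/-! ### Independence of groups of marks -/

/-- Groups are needed because the condition imposed by one AP involves two marks, its timer and its
fading. Joins of independent σ-algebras over disjoint index sets are independent, and events are
added one at a time. -/
lemma measure_biInter_of_disjoint_groups {Ω ι A : Type*} [mΩ : MeasurableSpace Ω] {P : Measure Ω}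
    [IsProbabilityMeasure P] {m : ι → MeasurableSpace Ω} (hm : ∀ i, m i ≤ mΩ) (h : iIndep m P)
    (G : A → Set ι) (hG : Pairwise fun a b => Disjoint (G a) (G b)) (E : A → Set Ω)
    (hE : ∀ a, MeasurableSet[⨆ i ∈ G a, m i] (E a)) (S : Finset A) :
    P (⋂ a ∈ S, E a) = ∏ a ∈ S, P (E a) := by
  classical
  induction S using Finset.induction_on with
  | empty => simp
  | insert a S ha ih =>
    have hd : Disjoint (G a) (⋃ b ∈ S, G b) := by
      simp only [Set.disjoint_iUnion_right]
      exact fun b hb => hG fun hab => ha (hab ▸ hb)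
    have hind := indep_iSup_of_disjoint hm h hd
    rw [Finset.set_biInter_insert, Finset.prod_insert ha, ← ih]
    refine (Indep_iff _ _ _).1 hind _ _ (hE a) ?_
    refine @Finset.measurableSet_biInter _ _ (⨆ i ∈ ⋃ b ∈ S, G b, m i) _ S fun b hb => ?_
    exact biSup_mono (f := m) (fun i hi => Set.mem_biUnion hb hi) _ (hE b)

/-- Continuity from above along finite index sets; the limit of the finite products is `infProd` by
definition. -/
lemma measure_iInter_of_disjoint_groups {Ω ι A : Type*} [mΩ : MeasurableSpace Ω] {P : Measure Ω}
    [IsProbabilityMeasure P] [Countable A] {m : ι → MeasurableSpace Ω} (hm : ∀ i, m i ≤ mΩ)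
    (h : iIndep m P) (G : A → Set ι) (hG : Pairwise fun a b => Disjoint (G a) (G b))
    (E : A → Set Ω) (hE : ∀ a, MeasurableSet[⨆ i ∈ G a, m i] (E a)) :
    P (⋂ a, E a) = infProd fun a => P (E a) := by
  have hE' : ∀ a, MeasurableSet (E a) := fun a => (iSup₂_le fun i _ => hm i) _ (hE a)
  have : ⋂ a, E a = ⋂ S : Finset A, ⋂ a ∈ S, E a := by
    ext ω
    simp only [Set.mem_iInter]
    exact ⟨fun h S a _ => h a, fun h a => h {a} a (Finset.mem_singleton_self a)⟩
  rw [this, Directed.measure_iInter]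
  · exact iInf_congr fun S => measure_biInter_of_disjoint_groups hm h G hG E hE S
  · exact fun S => (Finset.measurableSet_biInter S fun a _ => hE' a).nullMeasurableSet
  · refine directed_of_isDirected_le fun S T hST => ?_
    exact Set.biInter_subset_biInter_left hST
  · exact ⟨∅, measure_ne_top _ _⟩

lemma indepFun_compl {Ω ι : Type*} [MeasurableSpace Ω] {P : Measure Ω} {f : ι → Ω → ℝ}
    (hf : ∀ i, Measurable (f i)) (h : iIndepFun f P) (i : ι) :
    IndepFun (f i) (fun ω (j : {j // j ≠ i}) => f j ω) P := by
  have hd : Disjoint ({i} : Set ι) {j | j ≠ i} := by simp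
  have hind := indep_iSup_of_disjoint (fun j => (hf j).comap_le) h.iIndep hd
  rw [IndepFun_iff_Indep]
  refine indep_of_indep_of_le_left (indep_of_indep_of_le_right hind ?_) ?_
  · rw [MeasurableSpace.pi, MeasurableSpace.comap_iSup]
    refine iSup_le fun j => ?_
    rw [MeasurableSpace.comap_comp]
    exact le_iSup₂_of_le j.1 j.2 le_rfl
  · exact le_iSup₂_of_le i rfl le_rfl

/-! ### Distribution of the marks -/

section Laws

variable {Ω : Type*} [MeasurableSpace Ω] {P : Measure Ω} {p : Params}

lemma measure_signal_gt {X : Ω → ℝ} (hX : HasLaw X (expMeasure p.μ) P) {θ : ℝ} (hθ : 0 < θ)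
    {w : Plane} (hw : w ≠ 0) :
    P {ω | θ < X ω / p.pathLoss ‖w‖} = ENNReal.ofReal (p.detect θ w) := by
  have hl := Params.pathLoss_pos (p := p) (norm_pos_iff.2 hw)
  have := isProbabilityMeasure_expMeasure p.μ_pos
  have hset : {r : ℝ | θ < r / p.pathLoss ‖w‖} = (Set.Iic (θ * p.pathLoss ‖w‖))ᶜ := by
    ext r
    simp [lt_div_iff₀ hl]
  rw [hX.measure_eq (p := fun r => θ < r / p.pathLoss ‖w‖) (by rw [hset]; measurability), hset,
    prob_compl_eq_one_sub measurableSet_Iic, ← ofReal_cdf, cdf_expMeasure_eq p.μ_pos,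
    if_pos (by positivity), ← ENNReal.ofReal_one, ← ENNReal.ofReal_sub, Params.detect]
  · congr 1
    ring_nf
  · exact sub_nonneg.2 (Real.exp_le_one_iff.2 (by
      have := p.μ_pos
      have : 0 ≤ p.μ * (θ * p.pathLoss ‖w‖) := by positivity
      linarith))

/-- Probability that a signal sent over the displacement `w` is not received above `θ`. -/
def undetected (p : Params) (θ : ℝ) (w : Plane) : ℝ :=
  open Classical in if w = 0 then 1 else 1 - p.detect θ w

lemma measure_signal_le [IsProbabilityMeasure P] {X : Ω → ℝ}
    (hX : HasLaw X (expMeasure p.μ) P) (hXm : Measurable X)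
    {θ : ℝ} (hθ : 0 < θ) (w : Plane) :
    P {ω | X ω / p.pathLoss ‖w‖ ≤ θ} = ENNReal.ofReal (undetected p θ w) := by
  by_cases hw : w = 0
  -- At zero displacement the quotient is `X / 0 = 0`, so the event is sure although `detect` equals
  -- `1` there. This explains the special value in `undetected`.
  · have : p.pathLoss 0 = 0 := by simp [Params.pathLoss, Real.zero_rpow p.α_pos.ne']
    simp [hw, this, undetected, hθ.le]
  · have hset : {ω | X ω / p.pathLoss ‖w‖ ≤ θ} = {ω | θ < X ω / p.pathLoss ‖w‖}ᶜ := by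
      ext; simp
    rw [hset, prob_compl_eq_one_sub (measurableSet_lt measurable_const (hXm.div_const _)),
      measure_signal_gt hX hθ hw, ← ENNReal.ofReal_one,
      ← ENNReal.ofReal_sub _ (Params.detect_pos _).le, undetected, if_neg hw]

lemma measure_timer_lt {X : Ω → ℝ} (hX : HasLaw X (volume.restrict (Set.Icc (0 : ℝ) 1)) P)
    {s : ℝ} (hs : s ∈ Set.Icc (0 : ℝ) 1) : P {ω | X ω < s} = ENNReal.ofReal s := by
  have hset : {r : ℝ | r < s} ∩ Set.Icc 0 1 = Set.Ico 0 s := by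
    ext r
    simp only [Set.mem_inter_iff, Set.mem_ofPred_eq, Set.mem_Icc, Set.mem_Ico]
    constructor
    · rintro ⟨h1, h2, h3⟩; exact ⟨h2, h1⟩
    · rintro ⟨h1, h2⟩; exact ⟨h2, h1, h2.le.trans hs.2⟩
  have hm : MeasurableSet {r : ℝ | r < s} := measurableSet_Iio
  rw [hX.measure_eq (p := fun r => r < s) hm, Measure.restrict_apply hm, hset, Real.volume_Ico,
    sub_zero]

/-- Silencing requires an earlier timer and a detected signal, which are independent with
probabilities `s` and `detect`. The condition `‖z‖ < ‖w‖` also excludes `w = z`. -/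
lemma measure_not_silenced [IsProbabilityMeasure P] {T X : Ω → ℝ}
    (hT : HasLaw T (volume.restrict (Set.Icc (0 : ℝ) 1)) P)
    (hX : HasLaw X (expMeasure p.μ) P) (hTm : Measurable T) (hXm : Measurable X)
    (hind : IndepFun T X P) {s : ℝ} (hs : s ∈ Set.Icc (0 : ℝ) 1) (z w : Plane) :
    P {ω | ‖z‖ < ‖w‖ ∧ (T ω < s → X ω / p.pathLoss ‖w - z‖ ≤ p.Γcs / p.PW)} =
      ENNReal.ofReal (farther (p.quiet s) z w) := by
  by_cases hzw : ‖z‖ < ‖w‖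
  · have hne : w - z ≠ 0 := fun h => by
      rw [sub_eq_zero.1 h] at hzw
      exact lt_irrefl _ hzw
    have hset : {ω | ‖z‖ < ‖w‖ ∧ (T ω < s → X ω / p.pathLoss ‖w - z‖ ≤ p.Γcs / p.PW)} =
        (T ⁻¹' {r | r < s} ∩ X ⁻¹' {r | p.Γcs / p.PW < r / p.pathLoss ‖w - z‖})ᶜ := by
      ext ω
      simp [hzw]
    have hmX : MeasurableSet {r : ℝ | p.Γcs / p.PW < r / p.pathLoss ‖w - z‖} :=
      measurableSet_lt measurable_const (measurable_id.div_const _)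
    have hmT : MeasurableSet {r : ℝ | r < s} := measurableSet_Iio
    rw [hset, prob_compl_eq_one_sub ((hTm hmT).inter (hXm hmX)),
      hind.measure_inter_preimage_eq_mul _ _ hmT hmX]
    have h1 : P (T ⁻¹' {r | r < s}) = ENNReal.ofReal s := measure_timer_lt hT hs
    have h2 : P (X ⁻¹' {r | p.Γcs / p.PW < r / p.pathLoss ‖w - z‖}) =
        ENNReal.ofReal (p.detect (p.Γcs / p.PW) (w - z)) :=
      measure_signal_gt hX Params.Γcs_div_pos hne
    rw [h1, h2, ← ENNReal.ofReal_mul hs.1, ← ENNReal.ofReal_one,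
      ← ENNReal.ofReal_sub _ (mul_nonneg hs.1 (Params.detect_pos _).le), farther, if_pos hzw,
      Params.quiet]
  · simp [hzw, farther]

end Laws

/-! ### Access probability for frozen locations -/

section Network

variable {Ω κ : Type*} [MeasurableSpace Ω] [Countable κ] {P : Measure Ω} [IsProbabilityMeasure P]
  {p : Params} {x : ℕ → Ω → Plane} {y : κ → Ω → Plane} {t : ℕ → Ω → ℝ}
  {GW : ℕ → ℕ → Ω → ℝ} {GLW : κ → ℕ → Ω → ℝ}

/-- For fixed locations `xs` and `ys`, and timer `s` of the `i`-th AP: the condition imposed by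
each eNB and by each AP for the `i`-th AP to be the closest to the origin and to get access. -/
def clearEvent (p : Params) (t : ℕ → Ω → ℝ) (GW : ℕ → ℕ → Ω → ℝ) (GLW : κ → ℕ → Ω → ℝ) (i : ℕ)
    (xs : ℕ → Plane) (ys : κ → Plane) (s : ℝ) : κ ⊕ ℕ → Set Ω :=
  Sum.elim (fun k => {ω | GLW k i ω / p.pathLoss ‖ys k - xs i‖ ≤ p.Γed / p.PL})
    (fun j => {ω | j ≠ i → ‖xs i‖ < ‖xs j‖ ∧
      (t j ω < s → GW j i ω / p.pathLoss ‖xs j - xs i‖ ≤ p.Γcs / p.PW)})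

/-- With the timer frozen at `s`, eNB `k` enters only through `GLW k i` and AP `j` only through `t
j` and `GW j i`. These groups of marks are disjoint. -/
lemma IsNetwork.measure_iInter_clearEvent (h : IsNetwork P p x y t GW GLW) (i : ℕ)
    (xs : ℕ → Plane) (ys : κ → Plane) {s : ℝ} (hs : s ∈ Set.Icc (0 : ℝ) 1) :
    P (⋂ a, clearEvent p t GW GLW i xs ys s a) =
      (infProd fun k => ENNReal.ofReal (undetected p (p.Γed / p.PL) (ys k - xs i))) *
        others Set.univ (farther (p.quiet s)) xs i := by
  classical
  have hmt : ∀ j, Measurable (t j) := fun j => h.measurable_marks (Sum.inl j)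
  have hmW : ∀ j, Measurable (GW j i) := fun j => h.measurable_marks (Sum.inr (Sum.inl (j, i)))
  have hmL : ∀ k, Measurable (GLW k i) := fun k => h.measurable_marks (Sum.inr (Sum.inr (k, i)))
  let m : (ℕ ⊕ (ℕ × ℕ) ⊕ (κ × ℕ)) → MeasurableSpace Ω := fun a =>
    MeasurableSpace.comap (marks t GW GLW a) inferInstance
  let G : κ ⊕ ℕ → Set (ℕ ⊕ (ℕ × ℕ) ⊕ (κ × ℕ)) :=
    Sum.elim (fun k => {Sum.inr (Sum.inr (k, i))})
      (fun j => {Sum.inl j, Sum.inr (Sum.inl (j, i))})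
  have hG : Pairwise fun a b => Disjoint (G a) (G b) := by
    rintro (k | j) (k' | j') hne
    all_goals
      simp only [G, Sum.elim_inl, Sum.elim_inr, Set.disjoint_left]
      simp_all
  have hle : ∀ {a : κ ⊕ ℕ} {b}, b ∈ G a → Measurable[⨆ i ∈ G a, m i] (marks t GW GLW b) :=
    fun {a b} hb => (comap_measurable _).mono (le_iSup₂_of_le b hb le_rfl) le_rfl
  have hE : ∀ a, MeasurableSet[⨆ i ∈ G a, m i] (clearEvent p t GW GLW i xs ys s a) := by
    rintro (k | j)
    · have hk : Measurable[⨆ b ∈ G (Sum.inl k), m b] (GLW k i) :=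
        hle (b := Sum.inr (Sum.inr (k, i))) (by simp [G])
      exact hk (t := {r | r / p.pathLoss ‖ys k - xs i‖ ≤ p.Γed / p.PL})
        (measurableSet_le (measurable_id.div_const _) measurable_const)
    · have hj : Measurable[⨆ b ∈ G (Sum.inr j), m b] (GW j i) :=
        hle (b := Sum.inr (Sum.inl (j, i))) (by simp [G])
      have hj' : Measurable[⨆ b ∈ G (Sum.inr j), m b] (t j) :=
        hle (b := Sum.inl j) (by simp [G])
      have h1 := hj (t := {r | r / p.pathLoss ‖xs j - xs i‖ ≤ p.Γcs / p.PW})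
        (measurableSet_le (measurable_id.div_const _) measurable_const)
      have h2 := hj' (t := {r | r < s}) measurableSet_Iio
      have h3 : clearEvent p t GW GLW i xs ys s (Sum.inr j) = {ω | ¬ j ≠ i} ∪
          ({ω | ‖xs i‖ < ‖xs j‖} ∩ ((t j ⁻¹' {r | r < s})ᶜ ∪
            GW j i ⁻¹' {r | r / p.pathLoss ‖xs j - xs i‖ ≤ p.Γcs / p.PW})) := by
        ext ω
        simp only [clearEvent, Sum.elim_inr, Set.mem_ofPred_eq, Set.mem_union, Set.mem_inter_iff,
          Set.mem_compl_iff, Set.mem_preimage]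
        tauto
      rw [h3]
      exact (MeasurableSet.const _).union ((MeasurableSet.const _).inter (h2.compl.union h1))
  rw [measure_iInter_of_disjoint_groups (fun a => (h.measurable_marks a).comap_le)
    h.indep_marks.iIndep G hG _ hE, others, ← infProd_sum_elim]
  congr 1
  ext (k | j)
  · exact measure_signal_le (h.law_GLW k i) (hmL k) Params.Γed_div_pos _
  · by_cases hji : j = i
    · simp [clearEvent, hji]
    · have hind : IndepFun (t j) (GW j i) P :=
        h.indep_marks.indepFun (i := Sum.inl j) (j := Sum.inr (Sum.inl (j, i))) (by simp)
      simp only [clearEvent, Sum.elim_inr, ne_eq, hji, not_false_eq_true, forall_const,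
        Set.mem_univ, and_self, if_true]
      exact measure_not_silenced (h.law_t j) (h.law_GW j i) (hmt j) (hmW j) hind hs _ _

/-- For fixed locations `xs` and `ys`: the event that the `i`-th AP is the closest to the origin
and gets access. -/
def nearestAccess (p : Params) (i : ℕ) (xs : ℕ → Plane) (ys : κ → Plane)
    (ms : (ℕ ⊕ (ℕ × ℕ) ⊕ (κ × ℕ)) → ℝ) : Prop :=
  (∀ k, ms (Sum.inr (Sum.inr (k, i))) / p.pathLoss ‖ys k - xs i‖ ≤ p.Γed / p.PL) ∧
    ∀ j, j ≠ i → ‖xs i‖ < ‖xs j‖ ∧ (ms (Sum.inl j) < ms (Sum.inl i) →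
      ms (Sum.inr (Sum.inl (j, i))) / p.pathLoss ‖xs j - xs i‖ ≤ p.Γcs / p.PW)

/-- The timer `t i` is the only mark shared by the conditions of the different APs. It is
independent of all the other marks, so Fubini over its uniform law reduces to a frozen timer. -/
lemma IsNetwork.measure_nearestAccess (h : IsNetwork P p x y t GW GLW) (i : ℕ)
    (xs : ℕ → Plane) (ys : κ → Plane) :
    P {ω | nearestAccess p i xs ys fun m => marks t GW GLW m ω} =
      ∫⁻ s in Set.Icc (0 : ℝ) 1,
        (infProd fun k => ENNReal.ofReal (undetected p (p.Γed / p.PL) (ys k - xs i))) *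
        others Set.univ (farther (p.quiet s)) xs i := by
  classical
  let I : Type _ := {m : ℕ ⊕ (ℕ × ℕ) ⊕ (κ × ℕ) // m ≠ Sum.inl i}
  let K : Ω → I → ℝ := fun ω m => marks t GW GLW m ω
  have hK : Measurable K := measurable_pi_iff.2 fun m => h.measurable_marks m
  have hti : Measurable (t i) := h.measurable_marks (Sum.inl i)
  let D : Set (ℝ × (I → ℝ)) := {q |
    (∀ k, q.2 ⟨Sum.inr (Sum.inr (k, i)), by simp⟩ / p.pathLoss ‖ys k - xs i‖ ≤ p.Γed / p.PL) ∧
    ∀ j, ∀ hj : j ≠ i, ‖xs i‖ < ‖xs j‖ ∧ (q.2 ⟨Sum.inl j, by simpa using hj⟩ < q.1 →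
      q.2 ⟨Sum.inr (Sum.inl (j, i)), by simp⟩ / p.pathLoss ‖xs j - xs i‖ ≤ p.Γcs / p.PW)}
  have hev : ∀ m : I, Measurable fun q : ℝ × (I → ℝ) => q.2 m := fun m =>
    (measurable_pi_apply m).comp measurable_snd
  have hD : MeasurableSet D := by
    refine measurableSet_setOfPred.2 (Measurable.and (Measurable.forall fun k => ?_)
      (Measurable.forall fun j => Measurable.forall fun hj => measurable_const.and
        (Measurable.imp ?_ ?_)))
    · exact measurableSet_setOfPred.1 (measurableSet_le ((hev _).div_const _) measurable_const)
    · exact measurableSet_setOfPred.1 (measurableSet_lt (hev _) measurable_fst)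
    · exact measurableSet_setOfPred.1 (measurableSet_le ((hev _).div_const _) measurable_const)
  have hset : {ω | nearestAccess p i xs ys fun m => marks t GW GLW m ω} =
      (fun ω => (t i ω, K ω)) ⁻¹' D := rfl
  have hind : IndepFun (t i) K P := indepFun_compl h.measurable_marks h.indep_marks (Sum.inl i)
  rw [hset, ← Measure.map_apply (hti.prodMk hK) hD,
    (indepFun_iff_map_prod_eq_prod_map_map hti.aemeasurable hK.aemeasurable).1 hind,
    Measure.prod_apply hD, (h.law_t i).map_eq]
  refine setLIntegral_congr_fun measurableSet_Icc fun s hs => ?_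
  rw [← h.measure_iInter_clearEvent i xs ys hs, Measure.map_apply hK (measurable_prodMk_left hD)]
  congr 1
  ext ω
  simp only [Set.mem_iInter, Sum.forall]
  rfl

end Network

/-! ### The tagged access point -/

section Nearest

variable {Ω : Type*} {x : ℕ → Ω → Plane}

/-- The `i`-th point is strictly closer to the origin than all the others. -/
def IsNearest (x : ℕ → Ω → Plane) (i : ℕ) (ω : Ω) : Prop := ∀ j, j ≠ i → ‖x i ω‖ < ‖x j ω‖

lemma IsNearest.unique {i j : ℕ} {ω : Ω} (hi : IsNearest x i ω) (hj : IsNearest x j ω) : i = j := by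
  by_contra hij
  exact lt_asymm (hi j (Ne.symm hij)) (hj i hij)

lemma IsNearest.tagged_eq {i : ℕ} {ω : Ω} (hi : IsNearest x i ω) : tagged x ω = i := by
  have : {i | ∀ j, ‖x i ω‖ ≤ ‖x j ω‖} = {i} := by
    ext l
    simp only [Set.mem_ofPred_eq, Set.mem_singleton_iff]
    constructor
    · intro hl
      by_contra hli
      exact (hi l hli).not_ge (hl i)
    · rintro rfl j
      by_cases hjl : j = l
      · rw [hjl]
      · exact (hi j hjl).le
  rw [tagged, this, csInf_singleton]

/-- Expresses the nearest distance by a manifestly measurable formula that does not involve the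
index `tagged`. -/
lemma IsNearest.norm_eq {i : ℕ} {ω : Ω} (hi : IsNearest x i ω) :
    (⨅ j, ‖x j ω‖ₑ).toReal = ‖x i ω‖ := by
  have : ⨅ j, ‖x j ω‖ₑ = ‖x i ω‖ₑ := by
    refine le_antisymm (iInf_le _ i) (le_iInf fun j => ?_)
    by_cases hji : j = i
    · rw [hji]
    · exact enorm_le_iff_norm_le.2 (hi j hji).le
  rw [this, toReal_enorm]

/-- At `s = 0` nobody is silenced and only the order of the norms remains. This gives the
nearest-distance law as a special case of the access computation. -/
lemma others_farther_quiet_zero (p : Params) (i : ℕ) (ω : Ω) [Decidable (IsNearest x i ω)] :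
    others Set.univ (farther (p.quiet 0)) (fun j => x j ω) i =
      if IsNearest x i ω then 1 else 0 := by
  split_ifs with hi
  · refine le_antisymm infProd_le_one (le_iInf fun S => (Finset.prod_eq_one fun j _ => ?_).ge)
    by_cases hji : j = i
    · simp [hji]
    · simp [hji, farther, hi j hji, Params.quiet]
  · rw [IsNearest] at hi
    push Not at hi
    obtain ⟨j, hji, hj⟩ := hi
    refine le_antisymm ((iInf_le _ {j}).trans ?_) zero_le
    simp [hji, farther, not_lt.2 hj]

lemma measurableSet_isNearest [MeasurableSpace Ω] (hx : ∀ i, Measurable (x i)) (i : ℕ) :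
    MeasurableSet {ω | IsNearest x i ω} :=
  measurableSet_setOfPred.2 (Measurable.forall fun j => Measurable.forall fun _ =>
    measurableSet_setOfPred.1 (measurableSet_lt (hx i).norm (hx j).norm))

lemma measure_exists_of_isNearest [MeasurableSpace Ω] {P : Measure Ω}
    {Q : ℕ → Ω → Prop}
    (hQm : ∀ i, MeasurableSet {ω | Q i ω}) (hQ : ∀ i ω, Q i ω → IsNearest x i ω) :
    P {ω | ∃ i, Q i ω} = ∑' i, P {ω | Q i ω} := by
  have : {ω | ∃ i, Q i ω} = ⋃ i, {ω | Q i ω} := by ext; simp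
  rw [this, measure_iUnion (fun i j hij => ?_) hQm]
  refine Set.disjoint_left.2 fun ω hi hj => hij ((hQ i ω hi).unique (hQ j ω hj))

end Nearest

lemma Params.lintegral_fW (p : Params) :
    ∫⁻ r in Set.Ioi (0 : ℝ), ENNReal.ofReal (p.fW r) = 1 := by
  have hb : 0 < p.lamW * Real.pi := mul_pos p.lamW_pos Real.pi_pos
  rw [← ofReal_integral_eq_lintegral_ofReal integrableOn_fW
    ((ae_restrict_iff' measurableSet_Ioi).2 (ae_of_all _ fun r hr => fW_nonneg (le_of_lt hr)))]
  have h1 := integral_rpow_mul_exp_neg_mul_rpow (p := 2) (q := 1) (b := p.lamW * Real.pi)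
    two_pos (by norm_num) hb
  have h2 : ∀ r, p.fW r = 2 * (p.lamW * Real.pi) *
      (r ^ (1 : ℝ) * Real.exp (-(p.lamW * Real.pi) * r ^ (2 : ℝ))) := fun r => by
    simp only [fW, Real.rpow_one, Real.rpow_two]
    ring_nf
  simp_rw [h2]
  rw [integral_const_mul, h1]
  norm_num [Real.rpow_neg_one]
  field_simp
  exact div_self p.lamW_pos.ne'

section Poisson

variable {Ω : Type*} [MeasurableSpace Ω] {P : Measure Ω} [IsProbabilityMeasure P] {p : Params}
  {x : ℕ → Ω → Plane}

lemma IsPoissonProcess.lintegral_pairSum_quiet (h : IsPoissonProcess P p.lamW x) {A : Set Plane}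
    (hA : MeasurableSet A) {s : ℝ} (hs : s ∈ Set.Icc (0 : ℝ) 1) :
    ∫⁻ ω, pairSum x Set.univ (A.indicator 1) (farther (p.quiet s)) ω ∂P =
      ∫⁻ z in A, ENNReal.ofReal (p.lamW * Real.exp (-(p.lamW * Real.pi * ‖z‖ ^ 2)) *
        Real.exp (-(s * p.NW2 ‖z‖))) := by
  rw [h.lintegral_pairSum_farther p.lamW_pos.le hA (Params.continuous_quiet s)
    (Params.quiet_nonneg hs) (Params.quiet_le_one hs)
    (Params.integrable_one_sub_farther_quiet s)]
  simp_rw [Params.integral_one_sub_farther_quiet, neg_add, Real.exp_add, mul_assoc]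

lemma IsPoissonProcess.tsum_measure_isNearest (h : IsPoissonProcess P p.lamW x) {B : Set ℝ}
    (hB : MeasurableSet B) :
    ∑' i, P {ω | IsNearest x i ω ∧ ‖x i ω‖ ∈ B} =
      ∫⁻ r in Set.Ioi (0 : ℝ) ∩ B, ENNReal.ofReal (p.fW r) := by
  classical
  have hA : MeasurableSet {z : Plane | ‖z‖ ∈ B} := measurable_norm hB
  have hm : ∀ i, MeasurableSet {ω | IsNearest x i ω ∧ ‖x i ω‖ ∈ B} := fun i =>
    (measurableSet_isNearest h.measurable i).inter ((h.measurable i).norm hB)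
  have h1 := h.lintegral_pairSum_quiet hA (s := 0) (by simp)
  have h2 : ∀ ω, pairSum x Set.univ ({z : Plane | ‖z‖ ∈ B}.indicator 1) (farther (p.quiet 0)) ω =
      ∑' i, {ω | IsNearest x i ω ∧ ‖x i ω‖ ∈ B}.indicator 1 ω := by
    intro ω
    refine tsum_congr fun i => ?_
    rw [others_farther_quiet_zero]
    by_cases hi : IsNearest x i ω <;> by_cases hB' : ‖x i ω‖ ∈ B <;> simp [hi, hB']
  simp_rw [h2] at h1
  rw [lintegral_tsum fun i => (measurable_one.indicator (hm i)).aemeasurable] at h1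
  simp_rw [fun i => lintegral_indicator_one (μ := P) (hm i)] at h1
  rw [h1, ← lintegral_indicator hA]
  have h3 := Params.lintegral_void_mul (p := p) (F := B.indicator 1) (measurable_one.indicator hB)
    (fun r => Set.indicator_nonneg (by simp) r) (Set.indicator_le_self' (by simp))
  have h4 : ∀ z : Plane, {z : Plane | ‖z‖ ∈ B}.indicator (fun z => ENNReal.ofReal
      (p.lamW * Real.exp (-(p.lamW * Real.pi * ‖z‖ ^ 2)) * Real.exp (-(0 * p.NW2 ‖z‖)))) z =
      ENNReal.ofReal (p.lamW * Real.exp (-(p.lamW * Real.pi * ‖z‖ ^ 2)) *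
        B.indicator 1 ‖z‖) := by
    intro z
    by_cases hz : ‖z‖ ∈ B <;> simp [hz]
  simp_rw [h4]
  rw [h3, Set.inter_comm, ← Measure.restrict_restrict hB, ← lintegral_indicator hB]
  refine lintegral_congr fun r => ?_
  by_cases hr : r ∈ B <;> simp [hr]

/-- The events that the `i`-th point is strictly nearest are disjoint and their probabilities sum to
the mass of `f_W`, which is `1`. Ties and the absence of a minimum are thereby excluded together. -/
lemma IsPoissonProcess.ae_exists_isNearest (h : IsPoissonProcess P p.lamW x) :
    ∀ᵐ ω ∂P, ∃ i, IsNearest x i ω := by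
  have h1 := h.tsum_measure_isNearest .univ
  simp only [Set.mem_univ, and_true, Set.inter_univ, Params.lintegral_fW] at h1
  rw [← measure_exists_of_isNearest (measurableSet_isNearest h.measurable)
    fun _ _ => id] at h1
  refine (prob_compl_eq_zero_iff ?_).2 h1
  have : {ω | ∃ i, IsNearest x i ω} = ⋃ i, {ω | IsNearest x i ω} := by ext; simp
  rw [this]
  exact MeasurableSet.iUnion (measurableSet_isNearest h.measurable)

/-- Law of the distance from the origin to the nearest point. -/
theorem IsPoissonProcess.hasLaw_norm_tagged (h : IsPoissonProcess P p.lamW x) :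
    HasLaw (fun ω => ‖x (tagged x ω) ω‖)
      ((volume.restrict (Set.Ioi (0 : ℝ))).withDensity fun r => ENNReal.ofReal (p.fW r)) P := by
  have hae : (fun ω => ‖x (tagged x ω) ω‖) =ᵐ[P] fun ω => (⨅ j, ‖x j ω‖ₑ).toReal := by
    filter_upwards [h.ae_exists_isNearest] with ω ⟨i, hi⟩
    rw [hi.tagged_eq, hi.norm_eq]
  have hmeas : Measurable fun ω => (⨅ j, ‖x j ω‖ₑ).toReal :=
    (Measurable.iInf fun j => (h.measurable j).enorm).ennreal_toReal
  refine ⟨⟨_, hmeas, hae⟩, ?_⟩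
  ext B hB
  rw [Measure.map_congr hae, Measure.map_apply hmeas hB, withDensity_apply _ hB,
    Measure.restrict_restrict hB, Set.inter_comm, ← h.tsum_measure_isNearest hB,
    ← measure_exists_of_isNearest (Q := fun i ω => IsNearest x i ω ∧ ‖x i ω‖ ∈ B) (fun i =>
      (measurableSet_isNearest h.measurable i).inter ((h.measurable i).norm hB))
      fun _ _ hi => hi.1]
  refine measure_congr ?_
  filter_upwards [h.ae_exists_isNearest] with ω ⟨i, hi⟩
  refine propext ⟨fun hω => ⟨i, hi, ?_⟩, ?_⟩
  · rw [← hi.norm_eq]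
    exact hω
  · rintro ⟨j, hj, hjB⟩
    rw [← hj.norm_eq] at hjB
    exact hjB

end Poisson

/-! ### Medium access probability -/

lemma measurable_undetected (p : Params) (θ : ℝ) : Measurable (undetected p θ) :=
  Measurable.ite (measurableSet_singleton 0) measurable_const
    (measurable_const.sub Params.continuous_detect.measurable)

/-- Probability that no eNB is detected at a fixed point. -/
lemma IsPoissonProcess.lintegral_infProd_undetected {Ω κ : Type*} [MeasurableSpace Ω]
    [Countable κ] {P : Measure Ω} [IsProbabilityMeasure P] {p : Params} {y : κ → Ω → Plane}
    (h : IsPoissonProcess P p.lamL y) (z : Plane) :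
    ∫⁻ ω, (infProd fun k => ENNReal.ofReal (undetected p (p.Γed / p.PL) (y k ω - z))) ∂P =
      ENNReal.ofReal (Real.exp (-p.NL)) := by
  have hθ := Params.Γed_div_pos (p := p)
  -- The special value of `undetected` matters only at `w = z`, a null set.
  have hae : (fun w => 1 - undetected p (p.Γed / p.PL) (w - z)) =ᵐ[volume]
      fun w => p.detect (p.Γed / p.PL) (w - z) := by
    have : ∀ᵐ w : Plane, w ≠ z := by simp [ae_iff]
    filter_upwards [this] with w hw
    simp [undetected, sub_eq_zero, hw]
  rw [h.lintegral_infProd p.lamL_nonneg (v := fun w => undetected p (p.Γed / p.PL) (w - z))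
    ((measurable_undetected p _).comp (measurable_id.sub_const z)),
    integral_congr_ae hae, integral_sub_right_eq_self (p.detect (p.Γed / p.PL)), Params.NL_eq]
  · intro w
    rw [undetected]
    split_ifs
    exacts [zero_le_one, sub_nonneg.2 (Params.detect_le_one hθ _)]
  · intro w
    rw [undetected]
    split_ifs
    exacts [le_rfl, sub_le_self _ (Params.detect_pos _).le]
  · exact (Params.integrable_detect_sub hθ z).congr hae.symm

lemma lintegral_exp_neg_mul_Icc {N : ℝ} (hN : 0 < N) :
    ∫⁻ s in Set.Icc (0 : ℝ) 1, ENNReal.ofReal (Real.exp (-(s * N))) =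
      ENNReal.ofReal ((1 - Real.exp (-N)) / N) := by
  have hc : Continuous fun s : ℝ => Real.exp (-(s * N)) := by fun_prop
  rw [← ofReal_integral_eq_lintegral_ofReal hc.continuousOn.integrableOn_Icc
    (ae_of_all _ fun s => (Real.exp_pos _).le), integral_Icc_eq_integral_Ioc,
    ← intervalIntegral.integral_of_le zero_le_one]
  congr 1
  have : ∀ s ∈ Set.uIcc (0 : ℝ) 1,
      HasDerivAt (fun s => -(Real.exp (-(s * N)) / N)) (Real.exp (-(s * N))) s := by
    intro s _
    have h1 : HasDerivAt (fun s : ℝ => -(s * N)) (-(1 * N)) s := ((hasDerivAt_id s).mul_const N).neg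
    refine ((h1.exp).div_const N).neg.congr_deriv ?_
    rw [one_mul, mul_neg, neg_div, neg_neg, mul_div_cancel_right₀ _ hN.ne']
  rw [intervalIntegral.integral_eq_sub_of_hasDerivAt this (hc.intervalIntegrable _ _)]
  simp
  field_simp
  ring

lemma Params.measurable_farther_quiet (p : Params) :
    Measurable fun q : ℝ × Plane × Plane => farther (p.quiet q.1) q.2.1 q.2.2 := by
  refine Measurable.ite (measurableSet_lt measurable_snd.fst.norm measurable_snd.snd.norm)
    ?_ measurable_const
  exact measurable_const.sub (measurable_fst.mul
    (continuous_detect.measurable.comp (measurable_snd.snd.sub measurable_snd.fst)))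

lemma Params.measurable_others_quiet (p : Params) (i : ℕ) :
    Measurable fun q : ℝ × (ℕ → Plane) => others Set.univ (farther (p.quiet q.1)) q.2 i := by
  classical
  refine measurable_infProd fun j => ?_
  by_cases hij : j = i
  · simp [hij]
  · simp only [ne_eq, hij, not_false_eq_true, Set.mem_univ, and_self, if_true]
    have hx : ∀ l, Measurable fun q : ℝ × (ℕ → Plane) => q.2 l := fun l =>
      (measurable_pi_apply l).comp measurable_snd
    have hm : Measurable fun q : ℝ × (ℕ → Plane) => (q.1, q.2 i, q.2 j) :=
      measurable_fst.prodMk ((hx i).prodMk (hx j))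
    exact (p.measurable_farther_quiet.comp hm).ennreal_ofReal

lemma accessIndicator_eq_one_iff {Ω κ : Type*} {p : Params} {x : ℕ → Ω → Plane}
    {y : κ → Ω → Plane} {t : ℕ → Ω → ℝ} {GW : ℕ → ℕ → Ω → ℝ} {GLW : κ → ℕ → Ω → ℝ}
    {i : ℕ} {ω : Ω} (hi : IsNearest x i ω) :
    accessIndicator p x y t GW GLW i ω = 1 ↔
      nearestAccess p i (fun i => x i ω) (fun k => y k ω) fun m => marks t GW GLW m ω := by
  have hi' : ∀ j, j ≠ i → ‖x i ω‖ < ‖x j ω‖ := hi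
  simp only [accessIndicator, nearestAccess, marks, Sum.elim_inl, Sum.elim_inr]
  simp only [ite_eq_left_iff, zero_ne_one, imp_false, not_not]
  refine and_congr_right fun _ => forall₂_congr fun j hj => ?_
  simp [hi' j hj]

lemma IsNetwork.measurable_locations {Ω κ : Type*} [MeasurableSpace Ω] {P : Measure Ω}
    {p : Params} {x : ℕ → Ω → Plane} {y : κ → Ω → Plane} {t : ℕ → Ω → ℝ} {GW : ℕ → ℕ → Ω → ℝ}
    {GLW : κ → ℕ → Ω → ℝ} (h : IsNetwork P p x y t GW GLW) :
    Measurable (fun ω i => x i ω) ∧ Measurable (fun ω k => y k ω) :=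
  ⟨measurable_pi_iff.2 h.poissonW.measurable, measurable_pi_iff.2 h.poissonL.measurable⟩

lemma measurableSet_nearestAccess {κ : Type*} [Countable κ] (p : Params) (i : ℕ) :
    MeasurableSet {q : ((ℕ → Plane) × (κ → Plane)) × ((ℕ ⊕ (ℕ × ℕ) ⊕ (κ × ℕ)) → ℝ) |
      nearestAccess p i q.1.1 q.1.2 q.2} := by
  have hx : ∀ j, Measurable fun q : ((ℕ → Plane) × (κ → Plane)) ×
      ((ℕ ⊕ (ℕ × ℕ) ⊕ (κ × ℕ)) → ℝ) => q.1.1 j := fun j =>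
    (measurable_pi_apply j).comp measurable_fst.fst
  have hy : ∀ k, Measurable fun q : ((ℕ → Plane) × (κ → Plane)) ×
      ((ℕ ⊕ (ℕ × ℕ) ⊕ (κ × ℕ)) → ℝ) => q.1.2 k := fun k =>
    (measurable_pi_apply k).comp measurable_fst.snd
  have hm : ∀ m, Measurable fun q : ((ℕ → Plane) × (κ → Plane)) ×
      ((ℕ ⊕ (ℕ × ℕ) ⊕ (κ × ℕ)) → ℝ) => q.2 m := fun m =>
    (measurable_pi_apply m).comp measurable_snd
  have hl := Params.continuous_pathLoss (p := p) |>.measurable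
  refine measurableSet_setOfPred.2 (Measurable.and (Measurable.forall fun k => ?_)
    (Measurable.forall fun j => Measurable.forall fun hj => Measurable.and ?_
      (Measurable.imp ?_ ?_)))
  · exact measurableSet_setOfPred.1 (measurableSet_le
      ((hm _).div (hl.comp ((hy k).sub (hx i)).norm)) measurable_const)
  · exact measurableSet_setOfPred.1 (measurableSet_lt (hx i).norm (hx j).norm)
  · exact measurableSet_setOfPred.1 (measurableSet_lt (hm _) (hm _))
  · exact measurableSet_setOfPred.1 (measurableSet_le
      ((hm _).div (hl.comp ((hx j).sub (hx i)).norm)) measurable_const)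

section Network

variable {Ω κ : Type*} [MeasurableSpace Ω] {P : Measure Ω} {p : Params} {x : ℕ → Ω → Plane}
  {y : κ → Ω → Plane} {t : ℕ → Ω → ℝ} {GW : ℕ → ℕ → Ω → ℝ} {GLW : κ → ℕ → Ω → ℝ}

lemma IsNetwork.measurableSet_event [Countable κ] (h : IsNetwork P p x y t GW GLW) (i : ℕ) :
    MeasurableSet {ω | nearestAccess p i (fun i => x i ω) (fun k => y k ω)
      fun m => marks t GW GLW m ω} :=
  ((h.measurable_locations.1.prodMk h.measurable_locations.2).prodMk
    (measurable_pi_iff.2 h.measurable_marks)) (measurableSet_nearestAccess p i)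

variable [Countable κ] [IsProbabilityMeasure P]

/-- Given the locations, the probability is `V * R`, where `R` involves only the APs. Both factors
depend on `x i`, but the mean of `V` over the eNBs is `exp (-N^L)` for every position of that AP, so
it comes out of the integral. -/
lemma IsNetwork.measure_event (h : IsNetwork P p x y t GW GLW) (i : ℕ) :
    P {ω | nearestAccess p i (fun i => x i ω) (fun k => y k ω) fun m => marks t GW GLW m ω} =
      ENNReal.ofReal (Real.exp (-p.NL)) * ∫⁻ s in Set.Icc (0 : ℝ) 1,
        ∫⁻ ω, others Set.univ (farther (p.quiet s)) (fun j => x j ω) i ∂P := by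
  obtain ⟨hmx, hmy⟩ := h.measurable_locations
  have hmm : Measurable fun ω m => marks t GW GLW m ω := measurable_pi_iff.2 h.measurable_marks
  have hD := measurableSet_nearestAccess (κ := κ) p i
  have hU := p.measurable_others_quiet i
  let V : (ℕ → Plane) → (κ → Plane) → ℝ≥0∞ := fun xs ys =>
    infProd fun k => ENNReal.ofReal (undetected p (p.Γed / p.PL) (ys k - xs i))
  have hV : Measurable (Function.uncurry V) := measurable_infProd fun k =>
    ((measurable_undetected p _).comp (((measurable_pi_apply k).comp measurable_snd).sub
      ((measurable_pi_apply i).comp measurable_fst))).ennreal_ofReal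
  let R : (ℕ → Plane) → ℝ≥0∞ := fun xs =>
    ∫⁻ s in Set.Icc (0 : ℝ) 1, others Set.univ (farther (p.quiet s)) xs i
  have hR : Measurable R := hU.lintegral_prod_left'
  have h1 : P {ω | nearestAccess p i (fun i => x i ω) (fun k => y k ω)
      fun m => marks t GW GLW m ω} =
      ∫⁻ ω, V (fun j => x j ω) (fun k => y k ω) * R (fun j => x j ω) ∂P := by
    have hset : {ω | nearestAccess p i (fun i => x i ω) (fun k => y k ω)
        fun m => marks t GW GLW m ω} =
        (fun ω => (((fun i => x i ω), (fun k => y k ω)), fun m => marks t GW GLW m ω)) ⁻¹'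
          {q | nearestAccess p i q.1.1 q.1.2 q.2} := rfl
    rw [hset, ← Measure.map_apply ((hmx.prodMk hmy).prodMk hmm) hD,
      (indepFun_iff_map_prod_eq_prod_map_map (hmx.prodMk hmy).aemeasurable hmm.aemeasurable).1
        h.indep_locations_marks, Measure.prod_apply hD,
      lintegral_map (measurable_measure_prodMk_left hD) (hmx.prodMk hmy)]
    refine lintegral_congr fun ω => ?_
    rw [Measure.map_apply hmm (measurable_prodMk_left hD)]
    refine (h.measure_nearestAccess i (fun j => x j ω) (fun k => y k ω)).trans ?_
    have hpair : Measurable fun s : ℝ => (s, fun j => x j ω) :=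
      measurable_id.prodMk measurable_const
    have hUs := hU.comp hpair
    exact lintegral_const_mul _ hUs
  have hVR : Measurable fun q : (ℕ → Plane) × (κ → Plane) => V q.1 q.2 * R q.1 :=
    hV.mul (hR.comp measurable_fst)
  have h2 : ∫⁻ ω, V (fun j => x j ω) (fun k => y k ω) * R (fun j => x j ω) ∂P =
      ENNReal.ofReal (Real.exp (-p.NL)) * ∫⁻ ω, R (fun j => x j ω) ∂P := by
    rw [← lintegral_map (f := fun q : (ℕ → Plane) × (κ → Plane) => V q.1 q.2 * R q.1)
      (g := fun ω => ((fun j => x j ω), (fun k => y k ω))) hVR (hmx.prodMk hmy),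
      (indepFun_iff_map_prod_eq_prod_map_map hmx.aemeasurable hmy.aemeasurable).1
        h.indep_locations, lintegral_prod _ hVR.aemeasurable]
    have h3 : ∀ xs, ∫⁻ ys, V xs ys * R xs ∂(P.map fun ω k => y k ω) =
        ENNReal.ofReal (Real.exp (-p.NL)) * R xs := by
      intro xs
      have hVx := hV.comp (measurable_prodMk_left (x := xs))
      change Measurable (V xs) at hVx
      rw [lintegral_mul_const _ hVx, lintegral_map hVx hmy]
      congr 1
      exact h.poissonL.lintegral_infProd_undetected (xs i)
    simp_rw [h3]
    rw [lintegral_const_mul _ hR, lintegral_map hR hmx]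
  rw [h1, h2]
  congr 1
  refine lintegral_lintegral_swap ?_
  have hpair : Measurable fun q : Ω × ℝ => (q.2, fun j => x j q.1) :=
    measurable_snd.prodMk (hmx.comp measurable_fst)
  have hUs := hU.comp hpair
  exact hUs.aemeasurable

/-- The medium access probability of the tagged AP, as an integral of nonnegative functions. -/
theorem IsNetwork.measure_access (h : IsNetwork P p x y t GW GLW) :
    P {ω | accessIndicator p x y t GW GLW (tagged x ω) ω = 1} =
      ∫⁻ r in Set.Ioi (0 : ℝ), ENNReal.ofReal
        ((1 - Real.exp (-p.NW2 r)) / p.NW2 r * Real.exp (-p.NL) * p.fW r) := by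
  have hae : {ω | accessIndicator p x y t GW GLW (tagged x ω) ω = 1} =ᵐ[P]
      {ω | ∃ i, nearestAccess p i (fun i => x i ω) (fun k => y k ω)
        fun m => marks t GW GLW m ω} := by
    filter_upwards [h.poissonW.ae_exists_isNearest] with ω ⟨i, hi⟩
    refine propext ⟨fun hω => ⟨i, ?_⟩, ?_⟩
    · rw [← accessIndicator_eq_one_iff hi, ← hi.tagged_eq]
      exact hω
    · rintro ⟨j, hj⟩
      have hij : IsNearest x j ω := fun l hl => (hj.2 l hl).1
      rw [← accessIndicator_eq_one_iff hij, ← hij.tagged_eq] at hj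
      exact hj
  have hU := p.measurable_others_quiet
  obtain ⟨hmx, -⟩ := h.measurable_locations
  -- For each `s` the sum over `i` is a pair sum over all points, to which the Campbell–Mecke
  -- formula applies; polar coordinates then give the integral in `r`.
  have hswap : ∑' i, ∫⁻ s in Set.Icc (0 : ℝ) 1,
        ∫⁻ ω, others Set.univ (farther (p.quiet s)) (fun j => x j ω) i ∂P =
      ∫⁻ s in Set.Icc (0 : ℝ) 1, ∫⁻ r in Set.Ioi (0 : ℝ),
        ENNReal.ofReal (p.fW r * Real.exp (-(s * p.NW2 r))) := by
    have hpair : Measurable fun q : ℝ × Ω => (q.1, fun j => x j q.2) :=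
      measurable_fst.prodMk (hmx.comp measurable_snd)
    have hm : ∀ i, Measurable fun q : ℝ × Ω =>
        others Set.univ (farther (p.quiet q.1)) (fun j => x j q.2) i := by
      intro i
      have := (hU i).comp hpair
      exact this
    rw [← lintegral_tsum fun i => (hm i).lintegral_prod_right'.aemeasurable]
    refine setLIntegral_congr_fun measurableSet_Icc fun s hs => ?_
    have hm' : ∀ i, Measurable fun ω =>
        others Set.univ (farther (p.quiet s)) (fun j => x j ω) i := by
      intro i
      have := (hm i).comp (measurable_prodMk_left (x := s))
      exact this
    rw [← lintegral_tsum fun i => (hm' i).aemeasurable,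
      ← Params.lintegral_void_mul (F := fun r => Real.exp (-(s * p.NW2 r)))
        (Params.measurable_NW2.const_mul s).neg.exp (fun r => (Real.exp_pos _).le)
        (fun r => Real.exp_le_one_iff.2
          (neg_nonpos.2 (mul_nonneg hs.1 (Params.NW2_pos r).le)))]
    have := h.poissonW.lintegral_pairSum_quiet .univ hs
    simpa [pairSum] using this
  rw [measure_congr hae, measure_exists_of_isNearest h.measurableSet_event
    (fun i ω hi j hj => (hi.2 j hj).1)]
  simp_rw [h.measure_event]
  -- The timer is integrated first: `∫_0^1 exp (-s N) ds = (1 - exp (-N)) / N`.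
  rw [ENNReal.tsum_mul_left, hswap, lintegral_lintegral_swap, ← lintegral_const_mul]
  · refine setLIntegral_congr_fun measurableSet_Ioi fun r hr => ?_
    have hf : 0 ≤ p.fW r := Params.fW_nonneg (le_of_lt hr)
    simp_rw [ENNReal.ofReal_mul hf]
    rw [lintegral_const_mul _ (by fun_prop), lintegral_exp_neg_mul_Icc (Params.NW2_pos r),
      ← ENNReal.ofReal_mul hf, ← ENNReal.ofReal_mul (Real.exp_pos _).le]
    congr 1
    ring
  · refine Measurable.lintegral_prod_right' (f := fun q : ℝ × ℝ =>
      ENNReal.ofReal (p.fW q.1 * Real.exp (-(q.2 * p.NW2 q.1)))) ?_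
    exact ((Params.continuous_fW.measurable.comp measurable_fst).mul
      (measurable_snd.mul (Params.measurable_NW2.comp measurable_fst)).neg.exp).ennreal_ofReal
  · exact ((Params.continuous_fW.measurable.comp measurable_snd).mul
      (measurable_fst.mul (Params.measurable_NW2.comp measurable_snd)).neg.exp).ennreal_ofReal
        |>.aemeasurable

end Network

lemma Params.access_integrand_bounds (p : Params) (r : ℝ) :
    0 ≤ (1 - Real.exp (-p.NW2 r)) / p.NW2 r * Real.exp (-p.NL) ∧
      (1 - Real.exp (-p.NW2 r)) / p.NW2 r * Real.exp (-p.NL) ≤ 1 := by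
  have hN := NW2_pos (p := p) r
  have h0 : 0 ≤ (1 - Real.exp (-p.NW2 r)) / p.NW2 r :=
    div_nonneg (sub_nonneg.2 (Real.exp_le_one_iff.2 (by linarith))) hN.le
  have h1 : (1 - Real.exp (-p.NW2 r)) / p.NW2 r ≤ 1 := by
    rw [div_le_one hN]
    linarith [Real.add_one_le_exp (-p.NW2 r)]
  have hNL : 0 ≤ p.NL := by
    rw [NL_eq]
    exact mul_nonneg p.lamL_nonneg (integral_nonneg fun w => (detect_pos w).le)
  exact ⟨mul_nonneg h0 (Real.exp_pos _).le,
    mul_le_one₀ h1 (Real.exp_pos _).le (Real.exp_le_one_iff.2 (by linarith))⟩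

/-- The factor in front of `f_W` lies in `[0, 1]`, because `1 - exp (-N) ≤ N`, so `f_W` itself
dominates. -/
lemma Params.integrableOn_access (p : Params) :
    IntegrableOn (fun r => (1 - Real.exp (-p.NW2 r)) / p.NW2 r * Real.exp (-p.NL) * p.fW r)
      (Set.Ioi 0) := by
  have hN := measurable_NW2 (p := p)
  have hf := continuous_fW (p := p) |>.measurable
  refine (integrableOn_fW (p := p)).mono'
    ((((measurable_const.sub hN.neg.exp).div hN).mul_const _).mul hf).aestronglyMeasurable ?_
  refine (ae_restrict_iff' measurableSet_Ioi).2 (ae_of_all _ fun r (hr : 0 < r) => ?_)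
  have hb := p.access_integrand_bounds r
  rw [Real.norm_of_nonneg (mul_nonneg hb.1 (fW_nonneg hr.le))]
  exact mul_le_of_le_one_left (fW_nonneg hr.le) hb.2

end WiFiLTE

end

theorem mainTheorem2 {Ω κ : Type*} [MeasurableSpace Ω] [Countable κ]
    (P : Measure Ω) [IsProbabilityMeasure P] (p : WiFiLTE.Params)
    (x : ℕ → Ω → WiFiLTE.Plane) (y : κ → Ω → WiFiLTE.Plane)
    (t : ℕ → Ω → ℝ) (GW : ℕ → ℕ → Ω → ℝ) (GLW : κ → ℕ → Ω → ℝ)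
    (hnet : WiFiLTE.IsNetwork P p x y t GW GLW) :
    -- almost surely the tagged AP is the unique AP closest to the origin,
    (∀ᵐ ω ∂P, ∀ j, j ≠ WiFiLTE.tagged x ω → ‖x (WiFiLTE.tagged x ω) ω‖ < ‖x j ω‖) ∧
    -- its distance to the origin has density `f_W` on `(0, ∞)`,
    HasLaw (fun ω => ‖x (WiFiLTE.tagged x ω) ω‖)
      ((volume.restrict (Set.Ioi (0 : ℝ))).withDensity (fun r => ENNReal.ofReal (p.fW r))) P ∧
    -- and its medium access probability is given by the (convergent) integral.
    IntegrableOn (fun r => (1 - Real.exp (-p.NW2 r)) / p.NW2 r * Real.exp (-p.NL) * p.fW r)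
      (Set.Ioi 0) ∧
    P.real {ω | WiFiLTE.accessIndicator p x y t GW GLW (WiFiLTE.tagged x ω) ω = 1} =
      ∫ r in Set.Ioi (0 : ℝ),
        (1 - Real.exp (-p.NW2 r)) / p.NW2 r * Real.exp (-p.NL) * p.fW r := by
  refine ⟨?_, hnet.poissonW.hasLaw_norm_tagged, p.integrableOn_access, ?_⟩
  · filter_upwards [hnet.poissonW.ae_exists_isNearest] with ω ⟨i, hi⟩
    rw [hi.tagged_eq]
    exact hi
  · have hnn : ∀ᵐ r ∂(volume.restrict (Set.Ioi (0 : ℝ))),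
        0 ≤ (1 - Real.exp (-p.NW2 r)) / p.NW2 r * Real.exp (-p.NL) * p.fW r :=
      (ae_restrict_iff' measurableSet_Ioi).2 (ae_of_all _ fun r hr =>
        mul_nonneg (p.access_integrand_bounds r).1 (WiFiLTE.Params.fW_nonneg (le_of_lt hr)))
    rw [measureReal_def, hnet.measure_access,
      ← ofReal_integral_eq_lintegral_ofReal p.integrableOn_access hnn,
      ENNReal.toReal_ofReal (integral_nonneg_of_ae hnn)]
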